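/- **Notation.** All graphs are finite and simple. $K_m$, $I_m$, $P_m$ denote the complete graph, the edgeless graph and the path on $m$ vertices ($K_0$ is the graph without vertices), and $M_m$ is the matching consisting of $m$ independent edges. $G\cup H$ is the disjoint union, $kH$ the disjoint union of $k$ copies of $H$, and $G\vee H$ the join ($G\cup H$ together with all edges between $G$ and $H$). $\mathcal N(H,G)$ is the number of copies of $H$ in $G$ (subgraphs of $G$ isomorphic to $H$), and $\mathrm{ex}(n,H,\mathcal F)$ is the maximum of $\mathcal N(H,G)$ over all $n$-vertex graphs $G$ that contain no member of $\mathcal F$ as a subgraph. **Theorem.** Let $r\ge 2$ and $2\le p\le s$ be integers with $r\le p$ or $r>2p$ (in the latter case all the numbers below are $0$). Write $s-p+1=cp+d$ with integers $c\ge 0$ and $0\le d\le p-1$, and put $q=\left\lfloor\frac{s-p+1}{p-1}\right\rfloor$ and $t=s-(q+1)(p-1)$. For an integer $j\ge 0$ let $e(j)=0$ if $j=0$ and $e(j)=2j+1$ if $j\neq 0$. Define the following graphs on $n$ vertices: - $G_3=(K_{p-1}\vee I_{n-(p-1)-q(2p-1)-e(t)})\cup qK_{2p-1}\cup K_{e(t)}$;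 - $G_4=(K_{p-1}\vee I_{n-(p-1)-2cp-e(d)})\cup cK_{2p}\cup K_{e(d)}$; - if $1\le d\le p-2$ and $c+d+1\ge p$, $G_5=(K_{p-1}\vee I_{n-(p-1)-2p(c+d+1-p)-(p-d)(2p-1)})\cup(c+d+1-p)K_{2p}\cup(p-d)K_{2p-1}$; - if $1\le d\le p-1$, $G_6=(K_{p-1}\vee(K_2\cup I_{n-p-1-2cp}))\cup cK_{2p}$. Then for all $n\ge n_0(r,p,s)$: - if $d=0$, then $\mathrm{ex}(n,K_r,\{P_{2p+1},M_{s+1}\})=\max\{\mathcal N(K_r,G_3),\mathcal N(K_r,G_4)\}$; - if $1\le d\le p-2$, then $\mathrm{ex}(n,K_r,\{P_{2p+1},M_{s+1}\})=\max\{\mathcal N(K_r,G_3),\mathcal N(K_r,G_4),\mathcal N(K_r,G_5),\mathcal N(K_r,G_6)\}$, where the term $\mathcal N(K_r,G_5)$ is omitted if $c+d+1<p$; - if $d=p-1$, then $\mathrm{ex}(n,K_r,\{P_{2p+1},M_{s+1}\})=\max\{\mathcal N(K_r,G_3),\mathcal N(K_r,G_4),\mathcal N(K_r,G_6)\}$.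 -/

import Mathlib

namespace BoundedMatching

open SimpleGraph

/-- The join `G ∨ H`: the disjoint union of `G` and `H` together with all edges between them. -/
def join {V W : Type*} (G : SimpleGraph V) (H : SimpleGraph W) : SimpleGraph (V ⊕ W) where
  Adj
    | Sum.inl u, Sum.inl v => G.Adj u v
    | Sum.inr u, Sum.inr v => H.Adj u v
    | Sum.inl _, Sum.inr _ => True
    | Sum.inr _, Sum.inl _ => True
  symm := ⟨by
    rintro (u | u) (v | v) h
    · exact G.adj_symm h
    · trivial
    · trivial
    · exact H.adj_symm h⟩
  loopless := ⟨by
    rintro (u | u) h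
    · exact G.loopless.irrefl u h
    · exact H.loopless.irrefl u h⟩

/-- The disjoint union `k H` of `k` copies of `H`. -/
def copies {W : Type*} (k : ℕ) (H : SimpleGraph W) : SimpleGraph (Fin k × W) where
  Adj x y := x.1 = y.1 ∧ H.Adj x.2 y.2
  symm := ⟨fun _ _ h => ⟨h.1.symm, h.2.symm⟩⟩
  loopless := ⟨fun x h => H.loopless.irrefl x.2 h.2⟩

/-- The complete graph `K_m`. -/
abbrev K (m : ℕ) : SimpleGraph (Fin m) := ⊤

/-- The edgeless graph `I_m`. -/
abbrev I (m : ℕ) : SimpleGraph (Fin m) := ⊥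

/-- The matching `M_m`, consisting of `m` independent edges. -/
abbrev matching (m : ℕ) : SimpleGraph (Fin m × Fin 2) := copies m (K 2)

open scoped Classical in
/-- The generalized Turán number `ex(n, H, 𝓕)`: the maximum of `𝒩(H, G)`, the number of
(unlabelled) copies of `H` in `G`, over the `n`-vertex graphs `G` that contain no member of `𝓕`
as a subgraph. (It is `0` if there is no such `G`.) -/
noncomputable def ex {W : Type*} (n : ℕ) (H : SimpleGraph W) (𝓕 : Set (Σ V : Type, SimpleGraph V)) :
    ℕ :=
  Finset.sup (Finset.univ.filter fun G : SimpleGraph (Fin n) => ∀ F ∈ 𝓕, F.2.Free G)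
    fun G => G.copyCount H

/-- The number of vertices of the last clique of `G₃` and `G₄`: there is no such clique if the
remainder `t` is `0`, and it has `2 t + 1` vertices otherwise. -/
def lastOrder (t : ℕ) : ℕ := if t = 0 then 0 else 2 * t + 1

/-- `(K_{p-1} ∨ I_m) ∪ q K_{2p-1} ∪ K_e`, where `q = ⌊(s-p+1)/(p-1)⌋`, `t = s - (q+1)(p-1)`,
`e = 0` if `t = 0` and `e = 2t+1` if `t ≠ 0`, and `m` makes the total number of vertices `n`. -/
abbrev G₃ (n s p : ℕ) :=
  let q := (s - p + 1) / (p - 1)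
  let e := lastOrder (s - (q + 1) * (p - 1))
  join (K (p - 1)) (I (n - ((p - 1) + q * (2 * p - 1) + e))) ⊕g copies q (K (2 * p - 1)) ⊕g K e

/-- `(K_{p-1} ∨ I_m) ∪ c K_{2p} ∪ K_e`, where `e = 0` if `d = 0` and `e = 2d+1` if `d ≠ 0`, and `m`
makes the total number of vertices `n`. -/
abbrev G₄ (n p c d : ℕ) :=
  let e := lastOrder d
  join (K (p - 1)) (I (n - ((p - 1) + c * (2 * p) + e))) ⊕g copies c (K (2 * p)) ⊕g K e

/-- `(K_{p-1} ∨ I_m) ∪ (c+d+1-p) K_{2p} ∪ (p-d) K_{2p-1}`, where `m` makes the total number of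
vertices `n`. It is meant for `d ≤ p ≤ c + d + 1` only. -/
abbrev G₅ (n p c d : ℕ) :=
  join (K (p - 1)) (I (n - ((p - 1) + (c + d + 1 - p) * (2 * p) + (p - d) * (2 * p - 1))))
    ⊕g copies (c + d + 1 - p) (K (2 * p)) ⊕g copies (p - d) (K (2 * p - 1))

/-- `(K_{p-1} ∨ (K_2 ∪ I_m)) ∪ c K_{2p}`, where `m` makes the total number of vertices `n`. -/
abbrev G₆ (n p c : ℕ) :=
  join (K (p - 1)) (K 2 ⊕g I (n - ((p - 1) + 2 + c * (2 * p)))) ⊕g copies c (K (2 * p))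

end BoundedMatching

/-
Put `p = P + 1` and `r = k + 2`, and compare the number of copies of `K_r` in a graph on `n`
vertices with `n * P.choose (k + 1)`; the difference, the excess, is additive over connected
components.

Upper bound. A matching number at most `s` yields a vertex cover of size at most `2 s`. If no `P`
vertices have `P + 3` common neighbours, then all but boundedly many vertices have fewer than `P`
neighbours in the cover and the excess tends to `-∞`. Otherwise let `T` be such a core of `P`
vertices, and delete, as long as possible, vertices outside `T` of degree at most `P`, which does
not decrease the excess. Since there is no path on `2 P + 3` vertices, the component of `T` is then
`T` with at most one further edge, and by Ore's argument every other component has a Hamiltonian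
cycle, so that a component of order `m` uses `⌊m / 2⌋` edges of the matching and has at most the
excess of `K_m`. There remains a knapsack problem for the clique sizes; the excess of `K_{2j+1}` is
convex in `j`, hence an exchange argument leaves only the cliques of `G₃, …, G₆`.

Lower bound. Excesses and matching numbers add up over the components of `G₃, …, G₆`.
-/

namespace BoundedMatching

open Finset SimpleGraph

/-- The number of copies of `K_{k+2}` that a component `K_m` contains in excess of those that `m`
further vertices joined to a clique `K_P` would create. -/
def gain (P k m : ℕ) : ℤ := (m.choose (k + 2) : ℤ) - m * (P.choose (k + 1) : ℤ)

/-- The properties of gains that the optimisation over disjoint unions of cliques uses. Here `w j`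
stands for the gain of the best clique with matching number `j ≤ P`, `A` for the gain of
`K_{2P+2}`, and `E` for the gain of an edge placed inside the independent part of the join. -/
structure GainSystem (P : ℕ) (A E : ℤ) (w : ℕ → ℤ) : Prop where
  zero : w 0 = 0
  convex : ∀ j, w (j + 1) - w j ≤ w (j + 2) - w (j + 1)
  edge_nonneg : 0 ≤ E
  edge_le : E ≤ A
  edge_le_sub : E ≤ A - w P
  ratio : (P + 1) * w P ≤ P * A
  step : ∀ j, 0 < w j → E ≤ w (j + 1) - w j

/-- `M` is at least the total gain in each of the constructions `G₃, …, G₆` with `p = P + 1`. -/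
structure Dominates (P c d : ℕ) (A E : ℤ) (w : ℕ → ℤ) (M : ℤ) : Prop where
  three : (((c * (P + 1) + d) / P : ℕ) : ℤ) * w P + w ((c * (P + 1) + d) % P) ≤ M
  four : c * A + w d ≤ M
  five : 1 ≤ d → d + 1 ≤ P → P ≤ c + d →
    ((c + d - P : ℕ) : ℤ) * A + ((P + 1 - d : ℕ) : ℤ) * w P ≤ M
  six : 1 ≤ d → c * A + E ≤ M

lemma mul_add_unique {P a c j d : ℕ} (h : a * (P + 1) + j = c * (P + 1) + d) (hj : j ≤ P)
    (hd : d ≤ P) : a = c ∧ j = d := by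
  have hdiv (a : ℕ) {j : ℕ} (hj : j ≤ P) := (Nat.div_mod_unique (a := a * (P + 1) + j)
    (b := P + 1) (d := a) (c := j) (by omega)).2 ⟨by ring, Nat.lt_succ_of_le hj⟩
  obtain ⟨hac, hjd⟩ := hdiv a hj
  rw [h] at hac hjd
  exact ⟨hac.symm.trans (hdiv c hd).1, hjd.symm.trans (hdiv c hd).2⟩

namespace GainSystem

variable {P : ℕ} {A E : ℤ} {w : ℕ → ℤ}

lemma step_mono (h : GainSystem P A E w) {i j : ℕ} (hij : i ≤ j) :
    w (i + 1) - w i ≤ w (j + 1) - w j := by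
  induction j, hij using Nat.le_induction with
  | base => exact le_rfl
  | succ j _ ih => exact ih.trans (h.convex j)

lemma exchange (h : GainSystem P A E w) {i j : ℕ} (hij : i ≤ j) (t : ℕ) :
    w (i + t) + w j ≤ w i + w (j + t) := by
  induction t with
  | zero => simp
  | succ t ih =>
    have := h.step_mono (show i + t ≤ j + t by omega)
    rw [← add_assoc, ← add_assoc]
    linarith

lemma superadditive (h : GainSystem P A E w) (i j : ℕ) : w i + w j ≤ w (i + j) := by
  have := h.exchange (Nat.zero_le j) i
  rwa [h.zero, zero_add, zero_add, add_comm j] at this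

lemma add_le_fill (h : GainSystem P A E w) {i j : ℕ} (hi : i ≤ P) (hj : j ≤ P) (hij : P ≤ i + j) :
    w i + w j ≤ w P + w (i + j - P) := by
  have := h.exchange (show i + j - P ≤ j by omega) (P - j)
  rw [show i + j - P + (P - j) = i by omega, show j + (P - j) = P by omega] at this
  linarith

variable {c d : ℕ} {M : ℤ}

lemma le_of_remainder_zero (h : GainSystem P A E w) (hM : Dominates P c d A E w M) (hd : d ≤ P)
    (a b : ℕ) (hab : a * (P + 1) + b * P = c * (P + 1) + d) : a * A + b * w P ≤ M := by
  induction b using Nat.strong_induction_on generalizing a with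
  | _ b ih =>
    rcases le_or_gt (P + 1) b with hb | hb
    · obtain ⟨b, rfl⟩ := Nat.exists_eq_add_of_le hb
      have := ih b (by omega) (a + P) (by rw [← hab]; ring)
      have := h.ratio
      push_cast at *
      linarith
    · rcases b with _ | b
      · obtain ⟨rfl, rfl⟩ := mul_add_unique (j := 0) (by simpa using hab) (Nat.zero_le P) hd
        simpa [h.zero] using hM.four
      · obtain ⟨e, rfl⟩ := Nat.exists_eq_add_of_le (Nat.lt_succ_iff.1 hb)
        obtain ⟨rfl, rfl⟩ := mul_add_unique (a := a + b) (j := e + 1) (by rw [← hab]; ring)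
          (by omega) hd
        rcases b with _ | b
        · simpa [add_comm] using hM.four
        · have := hM.five (by omega) (by omega) (by omega)
          rwa [show a + (b + 1) + (e + 1) - (b + 1 + 1 + e) = a by omega,
            show b + 1 + 1 + e + 1 - (e + 1) = b + 1 + 1 by omega] at this

lemma le_of_step_ge (h : GainSystem P A E w) (hM : Dominates P c d A E w M) (hd : d ≤ P)
    (a b j : ℕ) (hj : j ≤ P) (hab : a * (P + 1) + b * P + j = c * (P + 1) + d)
    (hup : A - w P ≤ w (j + 1) - w j) : a * A + b * w P + w j ≤ M := by
  induction a generalizing b j with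
  | zero =>
    rcases hj.lt_or_eq with hj | rfl
    · have hthree := hM.three
      rw [← hab, zero_mul, zero_add, Nat.mul_comm, Nat.mul_add_div (by omega),
        Nat.div_eq_of_lt hj, Nat.mul_add_mod, Nat.mod_eq_of_lt hj] at hthree
      simpa using hthree
    · have := h.le_of_remainder_zero hM hd 0 (b + 1) (by rw [← hab]; ring)
      push_cast at *
      linarith
  | succ a ih =>
    rcases hj.lt_or_eq with hj | rfl
    · have := ih (b + 1) (j + 1) hj (by rw [← hab]; ring) (hup.trans (h.convex j))
      push_cast at *
      linarith
    · have := h.le_of_remainder_zero hM hd (a + 1) (b + 1) (by rw [← hab]; ring)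
      push_cast at *
      linarith

lemma le_of_step_le (h : GainSystem P A E w) (hM : Dominates P c d A E w M) (hd : d ≤ P)
    (a b j : ℕ) (hj : j + 1 ≤ P) (hab : a * (P + 1) + b * P + (j + 1) = c * (P + 1) + d)
    (hdown : w (j + 1) - w j ≤ A - w P) : a * A + b * w P + w (j + 1) ≤ M := by
  rcases b with _ | b
  · obtain ⟨rfl, rfl⟩ := mul_add_unique (j := j + 1) (by simpa using hab) hj hd
    simpa using hM.four
  · suffices ((a + 1 : ℕ) : ℤ) * A + b * w P + w j ≤ M by
      push_cast at *
      linarith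
    have hab' : (a + 1) * (P + 1) + b * P + j = c * (P + 1) + d := by rw [← hab]; ring
    rcases j with _ | j
    · simpa [h.zero] using h.le_of_remainder_zero hM hd (a + 1) b hab'
    · exact h.le_of_step_le hM hd (a + 1) b j (by omega) hab' ((h.convex j).trans hdown)

lemma le_of_cost_eq (h : GainSystem P A E w) (hM : Dominates P c d A E w M) (hd : d ≤ P)
    (a b j : ℕ) (hj : j ≤ P) (hab : a * (P + 1) + b * P + j = c * (P + 1) + d) :
    a * A + b * w P + w j ≤ M := by
  rcases j with _ | j
  · simpa [h.zero] using h.le_of_remainder_zero hM hd a b hab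
  · rcases le_total (A - w P) (w (j + 1 + 1) - w (j + 1)) with hup | hdown
    · exact h.le_of_step_ge hM hd a b (j + 1) hj hab hup
    · exact h.le_of_step_le hM hd a b j hj hab ((h.convex j).trans hdown)

lemma mul_add_edge_le (h : GainSystem P A E w) (hM : Dominates P c d A E w M) (hd : d ≤ P)
    {a : ℕ} (ha : a * (P + 1) + 1 ≤ c * (P + 1) + d) : a * A + E ≤ M := by
  have hA := h.edge_nonneg.trans h.edge_le
  rcases Nat.eq_zero_or_pos d with rfl | hd0
  · have hac : ((a + 1 : ℕ) : ℤ) * A ≤ c * A := by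
      refine mul_le_mul_of_nonneg_right (Int.ofNat_le.2 ?_) hA
      exact Nat.lt_of_mul_lt_mul_right (a := P + 1) (by omega)
    have hfour := hM.four
    rw [h.zero] at hfour
    push_cast at hac
    linarith [h.edge_le]
  · have hac : (a : ℤ) * A ≤ c * A := by
      refine mul_le_mul_of_nonneg_right (Int.ofNat_le.2 (Nat.lt_succ_iff.1 ?_)) hA
      exact Nat.lt_of_mul_lt_mul_right (a := P + 1) (by rw [Nat.succ_mul]; omega)
    linarith [hM.six hd0]

lemma exists_cost_succ (h : GainSystem P A E w) (a b : ℕ) {j : ℕ} (hj : j ≤ P)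
    (hbj : b ≠ 0 ∨ 0 < w j) :
    ∃ a' b' j', j' ≤ P ∧
      a' * (P + 1) + b' * P + j' = a * (P + 1) + b * P + j + 1 ∧
      a * A + b * w P + w j + E ≤ a' * A + b' * w P + w j' := by
  rcases b with _ | b
  · rcases hj.lt_or_eq with hj | rfl
    · exact ⟨a, 0, j + 1, hj, by ring, by linarith [h.step j (by simpa using hbj)]⟩
    · refine ⟨a + 1, 0, 0, Nat.zero_le j, by ring, ?_⟩
      push_cast
      linarith [h.edge_le_sub, h.zero]
  · refine ⟨a + 1, b, j, hj, by ring, ?_⟩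
    push_cast
    linarith [h.edge_le_sub]

lemma le_of_cost_add_eq (h : GainSystem P A E w) (hM : Dominates P c d A E w M) (hd : d ≤ P)
    (u a b j : ℕ) (hj : j ≤ P) (hab : a * (P + 1) + b * P + j + u = c * (P + 1) + d) :
    a * A + b * w P + w j + (min u 1 : ℕ) * E ≤ M := by
  induction u generalizing a b j with
  | zero => simpa using h.le_of_cost_eq hM hd a b j hj hab
  | succ u ih =>
    rw [min_eq_right (Nat.le_add_left 1 u), Nat.cast_one, one_mul]
    by_cases hbj : b ≠ 0 ∨ 0 < w j
    · obtain ⟨a', b', j', hj', hcost, hvalue⟩ := h.exists_cost_succ a b hj hbj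
      have hslack := mul_nonneg (Int.natCast_nonneg (min u 1)) h.edge_nonneg
      linarith [ih a' b' j' hj' (by omega)]
    · push Not at hbj
      obtain ⟨rfl, hw⟩ := hbj
      have := h.mul_add_edge_le hM hd (a := a) (by omega)
      push_cast
      linarith

theorem le_of_cost_le (h : GainSystem P A E w) (hM : Dominates P c d A E w M) (hd : d ≤ P)
    {a b j ε : ℕ} (hj : j ≤ P) (hε : ε ≤ 1)
    (hab : a * (P + 1) + b * P + j + ε ≤ c * (P + 1) + d) :
    a * A + b * w P + w j + ε * E ≤ M := by
  obtain ⟨u, hu⟩ := Nat.exists_eq_add_of_le hab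
  have hε' : (ε : ℤ) * E ≤ (min (ε + u) 1 : ℕ) * E :=
    mul_le_mul_of_nonneg_right (Int.ofNat_le.2 (by omega)) h.edge_nonneg
  linarith [h.le_of_cost_add_eq hM hd (ε + u) a b j hj (by omega)]

lemma exists_cost_add (h : GainSystem P A E w) (a b : ℕ) {i j : ℕ} (hi : i ≤ P) (hj : j ≤ P) :
    ∃ b' j', j' ≤ P ∧ a * (P + 1) + b' * P + j' = a * (P + 1) + b * P + j + i ∧
      a * A + b * w P + w j + w i ≤ a * A + b' * w P + w j' := by
  rcases le_total (i + j) P with hij | hij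
  · exact ⟨b, i + j, hij, by ring, by linarith [h.superadditive i j]⟩
  · refine ⟨b + 1, i + j - P, by omega, by rw [Nat.add_mul]; omega, ?_⟩
    push_cast
    linarith [h.add_le_fill hi hj hij]

end GainSystem

lemma choose_add_choose_le (P k i : ℕ) (hi : i ≤ P) :
    P.choose k + (P + 1).choose k ≤ (P - i).choose k + (P + 1 + i).choose k := by
  rcases k with _ | k
  · simp
  induction i with
  | zero => simp
  | succ i ih =>
    refine (ih (by omega)).trans ?_
    obtain ⟨m, hm⟩ : ∃ m, P - i = m + 1 := ⟨P - i - 1, by omega⟩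
    have := Nat.choose_le_choose k (show m ≤ P + 1 + i by omega)
    rw [show P - (i + 1) = m by omega, hm, ← add_assoc (P + 1), Nat.choose_succ_succ' m,
      Nat.choose_succ_succ' (P + 1 + i)]
    omega

lemma choose_sub_add_mul_le (P k i : ℕ) (hi : i ≤ P + 1) :
    (P + 1 - i).choose (k + 1) + i * (P.choose k + (P + 1).choose k) ≤
      (P + 1 + i).choose (k + 1) := by
  induction i with
  | zero => simp
  | succ i ih =>
    have hstep := choose_add_choose_le P k i (by omega)
    have ih := ih (by omega)
    rw [show P + 1 - i = P - i + 1 by omega, Nat.choose_succ_succ'] at ih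
    rw [show P + 1 - (i + 1) = P - i by omega, ← add_assoc (P + 1), Nat.choose_succ_succ',
      Nat.succ_mul]
    omega

lemma two_mul_choose_le (m k : ℕ) : 2 * m.choose (k + 2) ≤ (m - 1) * m.choose (k + 1) := by
  calc 2 * m.choose (k + 2) ≤ (k + 2) * m.choose (k + 2) := Nat.mul_le_mul_right _ (by omega)
    _ = (m - (k + 1)) * m.choose (k + 1) := by
      rw [mul_comm, Nat.choose_succ_right_eq, mul_comm]
    _ ≤ (m - 1) * m.choose (k + 1) := Nat.mul_le_mul_right _ (by omega)

lemma choose_succ_le_mul (m k : ℕ) : (m + 1).choose (k + 1) ≤ (m + 1) * m.choose k := by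
  rw [Nat.add_one_mul_choose_eq]
  exact Nat.le_mul_of_pos_right _ k.succ_pos

@[simp]
lemma lastOrder_zero : lastOrder 0 = 0 := rfl

lemma lastOrder_of_pos {j : ℕ} (hj : 1 ≤ j) : lastOrder j = 2 * j + 1 :=
  if_neg (Nat.one_le_iff_ne_zero.1 hj)

lemma gain_zero (P k : ℕ) : gain P k 0 = 0 := by simp [gain]

lemma gain_one (P k : ℕ) : gain P k 1 = -P.choose (k + 1) := by
  simp [gain, Nat.choose_eq_zero_of_lt (show 1 < k + 2 by omega)]

lemma gain_succ (P k m : ℕ) :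
    gain P k (m + 1) = gain P k m + m.choose (k + 1) - P.choose (k + 1) := by
  simp only [gain, Nat.choose_succ_succ' m]
  push_cast
  ring

lemma gain_le_gain_succ {P m : ℕ} (k : ℕ) (hm : P ≤ m) : gain P k m ≤ gain P k (m + 1) := by
  have := Int.ofNat_le.2 (Nat.choose_le_choose (k + 1) hm)
  rw [gain_succ]
  linarith

lemma gain_add_two_self (P k : ℕ) : gain P k (P + 2) = gain P k P + P.choose k := by
  rw [gain_succ P k (P + 1), gain_succ, Nat.choose_succ_succ' P]
  push_cast
  ring

lemma gain_lastOrder_succ_sub (P k j : ℕ) :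
    gain P k (lastOrder (j + 1)) - gain P k (lastOrder j) =
      (2 * j + 2).choose (k + 1) + (2 * j + 1).choose (k + 1) - 2 * P.choose (k + 1)
        - if j = 0 then (P.choose (k + 1) : ℤ) else 0 := by
  rw [lastOrder_of_pos j.succ_pos, show 2 * (j + 1) + 1 = 2 * j + 1 + 1 + 1 by ring,
    gain_succ P k (2 * j + 1 + 1), gain_succ]
  rcases j with _ | j
  · simp only [lastOrder_zero, gain_zero, gain_one, if_true, mul_zero, zero_add]
    ring
  · rw [lastOrder_of_pos j.succ_pos, if_neg j.succ_ne_zero]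
    ring

lemma gain_lastOrder_convex (P k j : ℕ) :
    gain P k (lastOrder (j + 1)) - gain P k (lastOrder j) ≤
      gain P k (lastOrder (j + 2)) - gain P k (lastOrder (j + 1)) := by
  rw [gain_lastOrder_succ_sub, gain_lastOrder_succ_sub P k (j + 1), if_neg j.succ_ne_zero]
  have heven := Nat.choose_le_choose (k + 1) (show 2 * j + 2 ≤ 2 * (j + 1) + 2 by omega)
  have hodd := Nat.choose_le_choose (k + 1) (show 2 * j + 1 ≤ 2 * (j + 1) + 1 by omega)
  have : (0 : ℤ) ≤ if j = 0 then (P.choose (k + 1) : ℤ) else 0 := by positivity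
  zify at heven hodd
  linarith

lemma choose_le_gain_two_mul_add_two (P k : ℕ) : (P.choose k : ℤ) ≤ gain P k (2 * P + 2) := by
  have hsum := choose_sub_add_mul_le P (k + 1) (P + 1) le_rfl
  have hmul : P.choose k ≤ (P + 1) * P.choose k := Nat.le_mul_of_pos_left _ P.succ_pos
  rw [Nat.sub_self, Nat.choose_zero_succ, Nat.choose_succ_succ' P,
    show P + 1 + (P + 1) = 2 * P + 2 by ring] at hsum
  zify at hsum hmul
  simp only [gain]
  push_cast
  linarith

lemma choose_le_gain_sub_gain (P k : ℕ) :
    (P.choose k : ℤ) ≤ gain P k (2 * P + 2) - gain P k (2 * P + 1) := by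
  have := Nat.choose_le_choose (k + 1) (show P + 1 ≤ 2 * P + 1 by omega)
  rw [Nat.choose_succ_succ' P] at this
  zify at this
  rw [gain_succ P k (2 * P + 1)]
  linarith

lemma mul_gain_le_mul_gain (P k : ℕ) :
    (P + 1) * gain P k (2 * P + 1) ≤ P * gain P k (2 * P + 2) := by
  have hchoose := two_mul_choose_le (2 * P + 1) k
  rw [Nat.add_sub_cancel, mul_assoc] at hchoose
  have : (0 : ℤ) ≤ (P + 1) * P.choose (k + 1) := by positivity
  rw [gain_succ P k (2 * P + 1)]
  simp only [gain]
  zify at hchoose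
  push_cast
  linarith

lemma choose_le_gain_lastOrder_step {P k j : ℕ} (hj : 0 < gain P k (lastOrder j)) :
    (P.choose k : ℤ) ≤ gain P k (lastOrder (j + 1)) - gain P k (lastOrder j) := by
  rcases j with _ | j
  · simp [gain_zero] at hj
  have hPj : P ≤ 2 * j + 2 := by
    by_contra! hlt
    have hchoose := (choose_succ_le_mul (2 * j + 2) (k + 1)).trans
      (Nat.mul_le_mul_left _ (Nat.choose_le_choose (k + 1) hlt.le))
    rw [lastOrder_of_pos j.succ_pos, show 2 * (j + 1) + 1 = 2 * j + 2 + 1 by ring, gain] at hj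
    zify at hchoose
    push_cast at hj
    linarith
  have heven := Nat.choose_le_choose (k + 1) (show P + 1 ≤ 2 * (j + 1) + 2 by omega)
  have hodd := Nat.choose_le_choose (k + 1) (show P ≤ 2 * (j + 1) + 1 by omega)
  rw [Nat.choose_succ_succ' P] at heven
  rw [gain_lastOrder_succ_sub, if_neg j.succ_ne_zero]
  zify at heven hodd
  linarith

theorem gainSystem {P : ℕ} (k : ℕ) (hP : 1 ≤ P) :
    GainSystem P (gain P k (2 * P + 2)) (P.choose k) (fun j => gain P k (lastOrder j)) where
  zero := gain_zero P k
  convex := gain_lastOrder_convex P k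
  edge_nonneg := Int.natCast_nonneg _
  edge_le := choose_le_gain_two_mul_add_two P k
  edge_le_sub := by simpa [lastOrder_of_pos hP] using choose_le_gain_sub_gain P k
  ratio := by simpa [lastOrder_of_pos hP] using mul_gain_le_mul_gain P k
  step _ := choose_le_gain_lastOrder_step

lemma gain_le_gain_lastOrder {P m : ℕ} (k : ℕ) (hm : P + 1 ≤ m) (h1 : 1 < m) :
    gain P k m ≤ gain P k (lastOrder (m / 2)) := by
  rw [lastOrder_of_pos (by omega)]
  rcases Nat.even_or_odd' m with ⟨i, rfl | rfl⟩
  · rw [Nat.mul_div_cancel_left _ two_pos]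
    exact gain_le_gain_succ k (by omega)
  · rw [show (2 * i + 1) / 2 = i by omega]

lemma exists_cost_add_clique {P m : ℕ} (k : ℕ) (hP : 1 ≤ P) (hm : P + 2 ≤ m)
    (hm' : m ≤ 2 * P + 2) (a b : ℕ) {j : ℕ} (hj : j ≤ P) :
    ∃ a' b' j', j' ≤ P ∧ a' * (P + 1) + b' * P + j' = a * (P + 1) + b * P + j + m / 2 ∧
      a * gain P k (2 * P + 2) + b * gain P k (lastOrder P) + gain P k (lastOrder j) +
        gain P k m ≤
      a' * gain P k (2 * P + 2) + b' * gain P k (lastOrder P) + gain P k (lastOrder j') := by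
  rcases hm'.lt_or_eq with hlt | rfl
  · obtain ⟨b', j', hj', hcost, hvalue⟩ :=
      (gainSystem k hP).exists_cost_add a b (show m / 2 ≤ P by omega) hj
    exact ⟨a, b', j', hj', hcost,
      by linarith [gain_le_gain_lastOrder (m := m) (P := P) k (by omega) (by omega)]⟩
  · refine ⟨a + 1, b, j, hj, by rw [Nat.add_mul]; omega, ?_⟩
    push_cast
    linarith

section Cliques

variable {V W : Type*} {G : SimpleGraph V} {H : SimpleGraph W}

open scoped Classical in
/-- The number of `r`-cliques of `G` inside `S`. -/
noncomputable def cliqueCount (G : SimpleGraph V) (r : ℕ) (S : Finset V) : ℕ :=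
  #((S.powersetCard r).filter fun t : Finset V => G.IsClique t)

open scoped Classical in
/-- The neighbours of `v` inside `S`. -/
noncomputable def nbrs (G : SimpleGraph V) (S : Finset V) (v : V) : Finset V :=
  {u ∈ S | G.Adj v u}

/-- The number of copies of `K_{k+2}` inside `S`, relative to `#S` vertices each joined to a
clique `K_P`. The clique `K_m` has excess `gain P k m`. -/
noncomputable def excess (G : SimpleGraph V) (P k : ℕ) (S : Finset V) : ℤ :=
  cliqueCount G (k + 2) S - #S * (P.choose (k + 1) : ℤ)

/-- `D` is a union of connected components of the subgraph induced on `S`. -/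
structure IsClosedIn (G : SimpleGraph V) (D S : Finset V) : Prop where
  subset : D ⊆ S
  mem_of_adj : ∀ x ∈ D, ∀ y ∈ S, G.Adj x y → y ∈ D

@[simp]
lemma mem_nbrs {S : Finset V} {v u : V} : u ∈ nbrs G S v ↔ u ∈ S ∧ G.Adj v u := by
  classical simp [nbrs]

lemma nbrs_subset (S : Finset V) (v : V) : nbrs G S v ⊆ S := fun _ hu => (mem_nbrs.1 hu).1

lemma nbrs_subset_nbrs {S S' : Finset V} (h : S ⊆ S') (v : V) : nbrs G S v ⊆ nbrs G S' v :=
  fun _ hu => mem_nbrs.2 ⟨h (mem_nbrs.1 hu).1, (mem_nbrs.1 hu).2⟩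

lemma cliqueCount_le_choose (r : ℕ) (S : Finset V) : cliqueCount G r S ≤ (#S).choose r := by
  classical exact (card_filter_le _ _).trans_eq (card_powersetCard r S)

lemma cliqueCount_eq_choose (r : ℕ) {S : Finset V} (hS : G.IsClique (S : Set V)) :
    cliqueCount G r S = (#S).choose r := by
  classical
  rw [← card_powersetCard, cliqueCount, filter_true_of_mem fun t ht =>
    hS.subset (coe_subset.2 (mem_powersetCard.1 ht).1)]

lemma cliqueCount_mono (r : ℕ) {S S' : Finset V} (h : S ⊆ S') :
    cliqueCount G r S ≤ cliqueCount G r S' := by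
  classical exact card_le_card (filter_subset_filter _ (powersetCard_mono h))

lemma cliqueCount_cons (r : ℕ) {S : Finset V} {v : V} (hv : v ∉ S) :
    cliqueCount G (r + 1) (S.cons v hv) =
      cliqueCount G (r + 1) S + cliqueCount G r (nbrs G S v) := by
  classical
  have hclique : ((S.powersetCard r).filter fun t : Finset V => G.IsClique (insert v t : Finset V))
      = ((nbrs G S v).powersetCard r).filter fun t : Finset V => G.IsClique t := by
    ext t
    simp only [mem_filter, mem_powersetCard, subset_iff, mem_nbrs, coe_insert, isClique_insert,
      mem_coe]
    constructor
    · rintro ⟨⟨htS, hcard⟩, hcl, hadj⟩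
      exact ⟨⟨fun x hx => ⟨htS hx, hadj x hx fun h => hv (h ▸ htS hx)⟩, hcard⟩, hcl⟩
    · rintro ⟨⟨ht, hcard⟩, hcl⟩
      exact ⟨⟨fun x hx => (ht hx).1, hcard⟩, hcl, fun x hx _ => (ht hx).2⟩
  have hinj : Set.InjOn (insert v) (S.powersetCard r : Set (Finset V)) := by
    intro t ht t' ht' h
    rw [← erase_insert fun hvt => hv ((mem_powersetCard.1 ht).1 hvt), h,
      erase_insert fun hvt => hv ((mem_powersetCard.1 ht').1 hvt)]
  rw [cliqueCount, cons_eq_insert, powersetCard_succ_insert hv, filter_union,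
    card_union_of_disjoint]
  · rw [filter_image, card_image_of_injOn (hinj.mono (coe_subset.2 (filter_subset _ _))), hclique,
      cliqueCount, cliqueCount]
  · refine disjoint_filter_filter (Finset.disjoint_left.2 fun t ht ht' => ?_)
    obtain ⟨t', -, rfl⟩ := mem_image.1 ht'
    exact hv ((mem_powersetCard.1 ht).1 (mem_insert_self v t'))

lemma cliqueCount_map (f : G ↪g H) (r : ℕ) (S : Finset V) :
    cliqueCount H r (S.map f.toEmbedding) = cliqueCount G r S := by
  classical
  rw [cliqueCount, powersetCard_map, filter_map, card_map, cliqueCount]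
  congr 2 with t
  simp [Set.Pairwise, IsClique]

open scoped Classical in
lemma IsClosedIn.cliqueCount_le (r : ℕ) {D S : Finset V} (hD : IsClosedIn G D S) :
    cliqueCount G r S ≤ cliqueCount G r D + cliqueCount G r (S \ D) := by
  refine (card_le_card fun t ht => ?_).trans (card_union_le _ _)
  simp only [mem_union, mem_filter, mem_powersetCard] at ht ⊢
  obtain ⟨⟨hsub, hcard⟩, hcl⟩ := ht
  by_cases htD : Disjoint t D
  · exact Or.inr ⟨⟨subset_sdiff.2 ⟨hsub, htD⟩, hcard⟩, hcl⟩
  · obtain ⟨x, hx, hxD⟩ := not_disjoint_iff.1 htD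
    refine Or.inl ⟨⟨fun y hy => ?_, hcard⟩, hcl⟩
    rcases eq_or_ne x y with rfl | hxy
    · exact hxD
    · exact hD.mem_of_adj x hxD y (hsub hy) (hcl hx hy hxy)

lemma cliqueCount_add_le_disjUnion (r : ℕ) {S S' : Finset V} (h : Disjoint S S') :
    cliqueCount G (r + 1) S + cliqueCount G (r + 1) S' ≤
      cliqueCount G (r + 1) (S.disjUnion S' h) := by
  classical
  rw [disjUnion_eq_union, cliqueCount, cliqueCount, ← card_union_of_disjoint]
  · exact card_le_card (union_subset
      (filter_subset_filter _ (powersetCard_mono subset_union_left))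
      (filter_subset_filter _ (powersetCard_mono subset_union_right)))
  · refine disjoint_filter_filter (Finset.disjoint_left.2 fun t ht ht' => ?_)
    obtain ⟨ht, hcard⟩ := mem_powersetCard.1 ht
    have := disjoint_self.1 (h.mono ht (mem_powersetCard.1 ht').1)
    simp [this] at hcard

lemma nonempty_iso_coe_iff {r : ℕ} {G' : G.Subgraph} [Fintype G'.verts] :
    Nonempty (K r ≃g G'.coe) ↔ G'.coe = ⊤ ∧ #G'.verts.toFinset = r := by
  rw [Set.toFinset_card]
  constructor
  · rintro ⟨e⟩
    refine ⟨?_, by simpa using (Fintype.card_congr e.toEquiv).symm⟩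
    ext a b
    rw [← e.symm.map_adj_iff, top_adj, top_adj, e.symm.injective.ne_iff]
  · rintro ⟨htop, rfl⟩
    rw [htop]
    exact ⟨Iso.completeGraph (Fintype.equivFin _).symm⟩

lemma coe_eq_top_iff {G' : G.Subgraph} :
    G'.coe = ⊤ ↔ G.IsClique G'.verts ∧ G' = (⊤ : G.Subgraph).induce G'.verts := by
  constructor
  · intro htop
    have hadj {a b : V} (ha : a ∈ G'.verts) (hb : b ∈ G'.verts) (hab : a ≠ b) : G'.Adj a b := by
      have : G'.coe.Adj ⟨a, ha⟩ ⟨b, hb⟩ := by rw [htop]; simpa using hab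
      exact this
    refine ⟨fun a ha b hb hab => (hadj ha hb hab).adj_sub, Subgraph.ext rfl ?_⟩
    ext a b
    exact ⟨fun h => ⟨h.fst_mem, h.snd_mem, h.adj_sub⟩, fun h => hadj h.1 h.2.1 h.2.2.ne⟩
  · rintro ⟨hclique, hG'⟩
    have hadj (a b : V) : G'.Adj a b ↔ a ∈ G'.verts ∧ b ∈ G'.verts ∧ G.Adj a b := by
      conv_lhs => rw [hG']
      rfl
    ext a b
    rw [Subgraph.coe_adj, hadj, top_adj]
    exact ⟨fun h hab => h.2.2.ne (congrArg _ hab),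
      fun h => ⟨a.2, b.2, hclique a.2 b.2 (Subtype.coe_ne_coe.2 h)⟩⟩

lemma copyCount_eq_cliqueCount [Fintype V] (G : SimpleGraph V) (r : ℕ) :
    G.copyCount (K r) = cliqueCount G r univ := by
  classical
  rw [copyCount, cliqueCount]
  refine card_nbij' (fun G' => G'.verts.toFinset) (fun t => (⊤ : G.Subgraph).induce t) ?_ ?_ ?_ ?_
  · intro G' hG'
    obtain ⟨htop, hcard⟩ := nonempty_iso_coe_iff.1 (mem_filter.1 hG').2
    refine mem_filter.2 ⟨mem_powersetCard.2 ⟨subset_univ _, hcard⟩, ?_⟩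
    rw [Set.coe_toFinset]
    exact (coe_eq_top_iff.1 htop).1
  · intro t ht
    obtain ⟨ht, hclique⟩ := mem_filter.1 ht
    refine mem_filter.2 ⟨mem_univ _, nonempty_iso_coe_iff.2 ⟨coe_eq_top_iff.2 ⟨hclique, rfl⟩, ?_⟩⟩
    simpa using (mem_powersetCard.1 ht).2
  · intro G' hG'
    have htop := (nonempty_iso_coe_iff.1 (mem_filter.1 hG').2).1
    simpa only [Set.coe_toFinset] using (coe_eq_top_iff.1 htop).2.symm
  · exact fun t _ => by simp

@[simp]
lemma excess_empty (G : SimpleGraph V) (P k : ℕ) : excess G P k ∅ = 0 := by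
  have := cliqueCount_le_choose (G := G) (k + 2) ∅
  rw [card_empty, Nat.choose_zero_succ, Nat.le_zero] at this
  simp [excess, this]

lemma excess_cons (P k : ℕ) {S : Finset V} {v : V} (hv : v ∉ S) :
    excess G P k (S.cons v hv) =
      excess G P k S + (cliqueCount G (k + 1) (nbrs G S v) - P.choose (k + 1) : ℤ) := by
  rw [excess, cliqueCount_cons, card_cons, excess]
  push_cast
  ring

lemma excess_cons_le {P : ℕ} (k : ℕ) {S : Finset V} {v : V} (hv : v ∉ S)
    (hdeg : #(nbrs G S v) ≤ P) : excess G P k (S.cons v hv) ≤ excess G P k S := by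
  have := (cliqueCount_le_choose (G := G) (k + 1) (nbrs G S v)).trans
    (Nat.choose_le_choose (k + 1) hdeg)
  rw [excess_cons]
  linarith [Int.ofNat_le.2 this]

lemma excess_le_excess_cons {P : ℕ} (k : ℕ) {S T : Finset V} {v : V} (hv : v ∉ S)
    (hT : G.IsClique (T : Set V)) (hcard : #T = P) (hTv : T ⊆ nbrs G S v) :
    excess G P k S ≤ excess G P k (S.cons v hv) := by
  have := cliqueCount_mono (G := G) (k + 1) hTv
  rw [cliqueCount_eq_choose (k + 1) hT, hcard] at this
  rw [excess_cons]
  linarith [Int.ofNat_le.2 this]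

lemma excess_le_gain (P k : ℕ) (S : Finset V) : excess G P k S ≤ gain P k #S :=
  sub_le_sub_right (Int.ofNat_le.2 (cliqueCount_le_choose (k + 2) S)) _

lemma excess_eq_gain (P k : ℕ) {S : Finset V} (hS : G.IsClique (S : Set V)) :
    excess G P k S = gain P k #S := by
  rw [excess, cliqueCount_eq_choose (k + 2) hS, gain]

lemma excess_map (f : G ↪g H) (P k : ℕ) (S : Finset V) :
    excess H P k (S.map f.toEmbedding) = excess G P k S := by
  rw [excess, cliqueCount_map, card_map, excess]

open scoped Classical in
lemma IsClosedIn.excess_le {D S : Finset V} (hD : IsClosedIn G D S) (P k : ℕ) :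
    excess G P k S ≤ excess G P k D + excess G P k (S \ D) := by
  have hcount := hD.cliqueCount_le (k + 2)
  simp only [excess, ← card_sdiff_add_card_eq_card hD.subset]
  zify at hcount
  push_cast
  linarith

lemma excess_add_le_disjUnion (P k : ℕ) {S S' : Finset V} (h : Disjoint S S') :
    excess G P k S + excess G P k S' ≤ excess G P k (S.disjUnion S' h) := by
  have hcount := cliqueCount_add_le_disjUnion (G := G) (k + 1) h
  simp only [excess, card_disjUnion]
  zify at hcount
  push_cast
  linarith

open scoped Classical in
lemma IsClosedIn.nbrs_subset_nbrs_sdiff {D S : Finset V} (hD : IsClosedIn G D S) {v : V}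
    (hv : v ∈ S \ D) : nbrs G S v ⊆ nbrs G (S \ D) v := by
  intro u hu
  obtain ⟨hvS, hvD⟩ := mem_sdiff.1 hv
  obtain ⟨huS, hvu⟩ := mem_nbrs.1 hu
  exact mem_nbrs.2 ⟨mem_sdiff.2 ⟨huS, fun huD => hvD (hD.mem_of_adj u huD v hvS hvu.symm)⟩, hvu⟩

lemma exists_peeled (P k : ℕ) (T S : Finset V) (hTS : T ⊆ S) :
    ∃ S', T ⊆ S' ∧ (∀ v ∈ S', v ∉ T → P + 1 ≤ #(nbrs G S' v)) ∧
      excess G P k S ≤ excess G P k S' := by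
  classical
  induction S using Finset.strongInduction with
  | H S ih =>
    by_cases hdeg : ∀ v ∈ S, v ∉ T → P + 1 ≤ #(nbrs G S v)
    · exact ⟨S, hTS, hdeg, le_rfl⟩
    · push Not at hdeg
      obtain ⟨v, hv, hvT, hdeg⟩ := hdeg
      obtain ⟨S', hTS', hdeg', hexcess⟩ := ih (S.erase v) (erase_ssubset hv)
        (subset_erase.2 ⟨hTS, hvT⟩)
      refine ⟨S', hTS', hdeg', le_trans ?_ hexcess⟩
      have hle := card_le_card (nbrs_subset_nbrs (G := G) (erase_subset v S) v)
      simpa [cons_eq_insert, insert_erase hv] using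
        excess_cons_le (G := G) (P := P) k (notMem_erase v S) (by omega)

end Cliques

section Matchings

variable {V W : Type*} {G : SimpleGraph V} {H : SimpleGraph W} {k k' : ℕ} {S S' : Finset V}

/-- `G` has `k` independent edges inside `S`. -/
def HasMatching (G : SimpleGraph V) : ℕ → Finset V → Prop
  | 0, _ => True
  | k + 1, S => ∃ u ∈ S, ∃ v ∈ S, G.Adj u v ∧ ∃ T ⊆ S, u ∉ T ∧ v ∉ T ∧ HasMatching G k T

lemma hasMatching_zero (G : SimpleGraph V) (S : Finset V) : HasMatching G 0 S := trivial

lemma HasMatching.mono (h : HasMatching G k S) (hS : S ⊆ S') : HasMatching G k S' := by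
  cases k with
  | zero => trivial
  | succ k =>
    obtain ⟨u, hu, v, hv, huv, T, hT, hrest⟩ := h
    exact ⟨u, hS hu, v, hS hv, huv, T, hT.trans hS, hrest⟩

lemma HasMatching.of_le (h : HasMatching G k S) (hk : k' ≤ k) : HasMatching G k' S := by
  induction k generalizing S k' with
  | zero => rwa [Nat.le_zero.1 hk]
  | succ k ih =>
    cases k' with
    | zero => trivial
    | succ k' =>
      obtain ⟨u, hu, v, hv, huv, T, hT, huT, hvT, hmatch⟩ := h
      exact ⟨u, hu, v, hv, huv, T, hT, huT, hvT, ih hmatch (Nat.succ_le_succ_iff.1 hk)⟩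

lemma HasMatching.add {U : Finset V} (h : HasMatching G k S) (h' : HasMatching G k' S')
    (hdisj : Disjoint S S') (hS : S ⊆ U) (hS' : S' ⊆ U) : HasMatching G (k + k') U := by
  classical
  induction k generalizing S U with
  | zero => simpa using h'.mono hS'
  | succ k ih =>
    obtain ⟨u, hu, v, hv, huv, T, hT, huT, hvT, hmatch⟩ := h
    have hS'U : S' ⊆ (U.erase u).erase v := subset_erase.2
      ⟨subset_erase.2 ⟨hS', disjoint_left.1 hdisj hu⟩, disjoint_left.1 hdisj hv⟩
    rw [Nat.add_right_comm]
    exact ⟨u, hS hu, v, hS hv, huv, (U.erase u).erase v,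
      (erase_subset _ _).trans (erase_subset _ _), by simp, by simp,
      ih hmatch (hdisj.mono_left hT)
        (subset_erase.2 ⟨subset_erase.2 ⟨hT.trans hS, huT⟩, hvT⟩) hS'U⟩

lemma HasMatching.two_mul_le_card (h : HasMatching G k S) : 2 * k ≤ #S := by
  classical
  induction k generalizing S with
  | zero => simp
  | succ k ih =>
    obtain ⟨u, hu, v, hv, huv, T, hT, huT, hvT, hmatch⟩ := h
    have hcard := card_le_card (insert_subset hu (insert_subset hv hT))
    rw [card_insert_of_notMem (by simp [huv.ne, huT]), card_insert_of_notMem hvT] at hcard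
    have := ih hmatch
    omega

lemma hasMatching_of_isCompleteBetween {T X : Finset V}
    (hTX : G.IsCompleteBetween (T : Set V) X) (hcard : #T ≤ #X) (hT : T ⊆ S) (hX : X ⊆ S) :
    HasMatching G #T S := by
  classical
  induction T using Finset.cons_induction generalizing X S with
  | empty => exact hasMatching_zero G S
  | cons t T ht ih =>
    rw [card_cons] at hcard ⊢
    obtain ⟨x, hx⟩ : X.Nonempty := card_pos.1 (by omega)
    have hadj : ∀ u ∈ T.cons t ht, ∀ y ∈ X, G.Adj u y := fun u hu y hy => hTX hu hy
    have htS := hT (mem_cons_self t T)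
    refine ⟨t, htS, x, hX hx, hadj t (mem_cons_self t T) x hx, (S.erase t).erase x,
      (erase_subset _ _).trans (erase_subset _ _), by simp, by simp,
      ih (X := X.erase x) (fun u hu y hy => ?_) (by rw [card_erase_of_mem hx]; omega) ?_ ?_⟩
    · exact hadj u (mem_cons_of_mem hu) y (mem_of_mem_erase hy)
    · intro u hu
      exact mem_erase.2 ⟨(hadj u (mem_cons_of_mem hu) x hx).ne,
        mem_erase.2 ⟨fun h => ht (h ▸ hu), hT (mem_cons_of_mem hu)⟩⟩
    · refine erase_subset_erase x (subset_erase.2 ⟨hX, fun htX => ?_⟩)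
      exact (hadj t (mem_cons_self t T) t htX).ne rfl

lemma hasMatching_of_isChain {l : List V} {S : Finset V} (hl : l.IsChain G.Adj) (hn : l.Nodup)
    (hlS : ∀ x ∈ l, x ∈ S) : HasMatching G (l.length / 2) S := by
  classical
  match l with
  | [] | [_] => simpa using hasMatching_zero G S
  | a :: b :: l =>
    simp only [List.nodup_cons, List.mem_cons, not_or] at hn
    rw [show (a :: b :: l).length / 2 = l.length / 2 + 1 by simp only [List.length_cons]; omega]
    refine ⟨a, hlS a (by simp), b, hlS b (by simp), (List.isChain_cons_cons.1 hl).1,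
      l.toFinset, fun x hx => hlS x ?_, by simpa using hn.1.2, by simpa using hn.2.1,
      hasMatching_of_isChain (l := l) hl.tail.tail hn.2.2 fun x hx => List.mem_toFinset.2 hx⟩
    simp [List.mem_toFinset.1 hx]

lemma HasMatching.exists_copy (h : HasMatching G k S) :
    ∃ f : Copy (matching k) G, ∀ e, f e ∈ S := by
  induction k generalizing S with
  | zero => exact ⟨⟨⟨fun e => e.1.elim0, fun {e} => e.1.elim0⟩, fun e => e.1.elim0⟩,
      fun e => e.1.elim0⟩
  | succ k ih =>
    obtain ⟨u, hu, v, hv, huv, T, hT, huT, hvT, hmatch⟩ := h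
    obtain ⟨f, hf⟩ := ih hmatch
    have hfu (e) : f e ≠ u := fun h => huT (h ▸ hf e)
    have hfv (e) : f e ≠ v := fun h => hvT (h ▸ hf e)
    let g (e : Fin (k + 1) × Fin 2) : V := Fin.cases (![u, v] e.2) (fun i => f (i, e.2)) e.1
    have hg_adj : ∀ {e e'}, (matching (k + 1)).Adj e e' → G.Adj (g e) (g e') := by
      rintro ⟨i, a⟩ ⟨_, b⟩ ⟨rfl, hab⟩
      induction i using Fin.cases with
      | zero => fin_cases a <;> fin_cases b <;> simp_all [g, huv.symm]
      | succ i => exact f.toHom.map_adj ⟨rfl, hab⟩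
    have hg_inj : Function.Injective g := by
      rintro ⟨i, a⟩ ⟨j, b⟩ h
      have huv_inj : Function.Injective ![u, v] := by
        simpa [Function.Injective] using ⟨huv.ne, huv.ne'⟩
      have huv_ne (a e) : ![u, v] a ≠ f e := by fin_cases a <;> simp [(hfu e).symm, (hfv e).symm]
      induction i using Fin.cases <;> induction j using Fin.cases
      · rw [huv_inj h]
      · exact absurd h (huv_ne _ _)
      · exact absurd h.symm (huv_ne _ _)
      · obtain ⟨hij, hab⟩ := Prod.mk.inj (f.injective h)
        exact Prod.ext (congrArg Fin.succ hij) hab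
    refine ⟨⟨⟨g, hg_adj⟩, hg_inj⟩, ?_⟩
    rintro ⟨i, a⟩
    induction i using Fin.cases with
    | zero => fin_cases a <;> simpa [g]
    | succ i => exact hT (hf _)

lemma hasMatching_map_copy (f : Copy (matching k) G) (s : Finset (Fin k)) :
    HasMatching G #s ((s ×ˢ univ).map f.toEmbedding) := by
  induction s using Finset.cons_induction with
  | empty => exact hasMatching_zero G _
  | cons i s hi ih =>
    rw [card_cons]
    have hmem {j : Fin k} (hj : j ∉ s) (a : Fin 2) :
        f (j, a) ∉ (s ×ˢ univ).map f.toEmbedding := by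
      rw [mem_map]
      rintro ⟨e, he, h⟩
      obtain rfl : e = (j, a) := f.injective h
      exact hj (mem_product.1 he).1
    refine ⟨f (i, 0), mem_map.2 ⟨(i, 0), by simp, rfl⟩, f (i, 1), mem_map.2 ⟨(i, 1), by simp, rfl⟩,
      f.toHom.map_adj ⟨rfl, by simp⟩, (s ×ˢ univ).map f.toEmbedding,
      map_subset_map.2 (product_subset_product_left (subset_cons hi)), hmem hi 0, hmem hi 1, ih⟩

lemma hasMatching_univ_iff [Fintype V] : HasMatching G k univ ↔ matching k ⊑ G := by
  refine ⟨fun h => ⟨h.exists_copy.choose⟩, fun ⟨f⟩ => ?_⟩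
  simpa using (hasMatching_map_copy f univ).mono (subset_univ _)

lemma exists_cover_of_not_hasMatching {s : ℕ} (h : ¬ HasMatching G (s + 1) S) :
    ∃ U : Finset V, #U ≤ 2 * s ∧ ∀ u ∈ S, ∀ v ∈ S, u ∉ U → v ∉ U → ¬ G.Adj u v := by
  classical
  induction s generalizing S with
  | zero =>
    exact ⟨∅, by simp, fun u hu v hv _ _ huv =>
      h ⟨u, hu, v, hv, huv, ∅, empty_subset S, by simp, by simp, trivial⟩⟩
  | succ s ih =>
    by_cases hS : ∃ u ∈ S, ∃ v ∈ S, G.Adj u v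
    · obtain ⟨u, hu, v, hv, huv⟩ := hS
      obtain ⟨U, hcard, hind⟩ := ih (S := (S.erase u).erase v) fun hmatch =>
        h ⟨u, hu, v, hv, huv, _, (erase_subset _ _).trans (erase_subset _ _), by simp, by simp,
          hmatch⟩
      refine ⟨insert u (insert v U), ?_, ?_⟩
      · have hu_card := card_insert_le u (insert v U)
        have hv_card := card_insert_le v U
        omega
      · intro x hx y hy hxU hyU
        simp only [mem_insert, not_or] at hxU hyU
        exact hind x (by simp [hx, hxU]) y (by simp [hy, hyU]) hxU.2.2 hyU.2.2
    · push Not at hS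
      exact ⟨∅, by simp, fun u hu v hv _ _ => hS u hu v hv⟩

lemma HasMatching.of_sum {S : Finset (V ⊕ W)} (h : HasMatching (G ⊕g H) k S) :
    ∃ i j, i + j = k ∧ HasMatching G i S.toLeft ∧ HasMatching H j S.toRight := by
  induction k generalizing S with
  | zero => exact ⟨0, 0, rfl, trivial, trivial⟩
  | succ k ih =>
    obtain ⟨u, hu, v, hv, huv, T, hT, huT, hvT, hmatch⟩ := h
    obtain ⟨i, j, rfl, hi, hj⟩ := ih hmatch
    rcases u with u | u <;> rcases v with v | v
    · exact ⟨i + 1, j, by ring, ⟨u, mem_toLeft.2 hu, v, mem_toLeft.2 hv, huv, T.toLeft,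
        toLeft_subset_toLeft hT, by simpa using huT, by simpa using hvT, hi⟩,
        hj.mono (toRight_subset_toRight hT)⟩
    · simp at huv
    · simp at huv
    · exact ⟨i, j + 1, by ring, hi.mono (toLeft_subset_toLeft hT), ⟨u, mem_toRight.2 hu, v,
        mem_toRight.2 hv, huv, T.toRight, toRight_subset_toRight hT, by simpa using huT,
        by simpa using hvT, hj⟩⟩

lemma HasMatching.of_join {S : Finset (V ⊕ W)} (h : HasMatching (join G H) k S) :
    ∃ i j, i + j = k ∧ i ≤ #S.toLeft ∧ HasMatching H j S.toRight := by
  induction k generalizing S with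
  | zero => exact ⟨0, 0, rfl, Nat.zero_le _, trivial⟩
  | succ k ih =>
    obtain ⟨u, hu, v, hv, huv, T, hT, huT, hvT, hmatch⟩ := h
    obtain ⟨i, j, rfl, hi, hj⟩ := ih hmatch
    have hleft {t : V} (ht : Sum.inl t ∈ S) (htT : Sum.inl t ∉ T) : i + 1 ≤ #S.toLeft :=
      hi.trans_lt (card_lt_card ((ssubset_iff_of_subset (toLeft_subset_toLeft hT)).2
        ⟨t, mem_toLeft.2 ht, by simpa using htT⟩))
    have hj' := hj.mono (toRight_subset_toRight hT)
    rcases u with u | u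
    · exact ⟨i + 1, j, by ring, hleft hu huT, hj'⟩
    rcases v with v | v
    · exact ⟨i + 1, j, by ring, hleft hv hvT, hj'⟩
    · exact ⟨i, j + 1, by ring, hi.trans (card_le_card (toLeft_subset_toLeft hT)), ⟨u,
        mem_toRight.2 hu, v, mem_toRight.2 hv, huv, T.toRight, toRight_subset_toRight hT,
        by simpa using huT, by simpa using hvT, hj⟩⟩

end Matchings

section Paths

variable {V : Type*} {G : SimpleGraph V} {S : Finset V} {l : List V}

/-- `l` lists the vertices of a path of `G` inside `S`, in order. -/
structure IsPathIn (G : SimpleGraph V) (S : Finset V) (l : List V) : Prop where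
  chain : l.IsChain G.Adj
  nodup : l.Nodup
  subset : ∀ x ∈ l, x ∈ S

/-- `l` lists the vertices of a path of `G` inside `S` of maximal length. -/
structure IsLongestPathIn (G : SimpleGraph V) (S : Finset V) (l : List V) : Prop
    extends IsPathIn G S l where
  length_le : ∀ l', IsPathIn G S l' → l'.length ≤ l.length

lemma pathGraph_isContained_iff {m : ℕ} :
    pathGraph m ⊑ G ↔ ∃ l : List V, l.IsChain G.Adj ∧ l.Nodup ∧ l.length = m := by
  constructor
  · rintro ⟨f⟩
    refine ⟨List.ofFn f, ?_, List.nodup_ofFn.2 f.injective, List.length_ofFn⟩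
    rw [List.isChain_ofFn]
    exact fun i hi => f.toHom.map_adj (pathGraph_adj.2 (Or.inl rfl))
  · rintro ⟨l, hl, hn, rfl⟩
    refine ⟨⟨⟨fun i => l[i], fun {i j} hij => ?_⟩, hn.injective_get⟩⟩
    have hchain := List.isChain_iff_getElem.1 hl
    obtain ⟨i, hi⟩ := i
    obtain ⟨j, hj⟩ := j
    rcases pathGraph_adj.1 hij with rfl | rfl
    · exact hchain i hj
    · exact (hchain j hi).symm

lemma length_le_of_pathGraph_free {m : ℕ} (hG : (pathGraph (m + 1)).Free G)
    (hl : l.IsChain G.Adj) (hn : l.Nodup) : l.length ≤ m := by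
  by_contra! hlt
  exact hG (pathGraph_isContained_iff.2 ⟨l.take (m + 1), hl.take _, hn.sublist (l.take_sublist _),
    by simpa using hlt⟩)

lemma IsPathIn.reverse (h : IsPathIn G S l) : IsPathIn G S l.reverse where
  chain := List.isChain_reverse.2 (h.chain.imp fun _ _ hadj => hadj.symm)
  nodup := List.nodup_reverse.2 h.nodup
  subset x hx := h.subset x (List.mem_reverse.1 hx)

lemma IsPathIn.length_le_card (h : IsPathIn G S l) : l.length ≤ #S := by
  classical
  rw [← List.toFinset_card_of_nodup h.nodup]
  exact card_le_card fun x hx => h.subset x (List.mem_toFinset.1 hx)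

lemma IsLongestPathIn.reverse (h : IsLongestPathIn G S l) : IsLongestPathIn G S l.reverse where
  toIsPathIn := h.toIsPathIn.reverse
  length_le l' hl' := by simpa using h.length_le l' hl'

lemma exists_isLongestPathIn (G : SimpleGraph V) (S : Finset V) :
    ∃ l, IsLongestPathIn G S l := by
  classical
  let Q (m : ℕ) : Prop := ∃ l, IsPathIn G S l ∧ l.length = m
  obtain ⟨l, hl, hlen⟩ : Q (Nat.findGreatest Q #S) :=
    Nat.findGreatest_spec (P := Q) (Nat.zero_le _) ⟨[], ⟨by simp, by simp, by simp⟩, rfl⟩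
  exact ⟨l, hl, fun l' hl' => hlen ▸ Nat.le_findGreatest hl'.length_le_card ⟨l', hl', rfl⟩⟩

lemma IsLongestPathIn.mem_of_adj_head {a y : V} (h : IsLongestPathIn G S (a :: l)) (hy : y ∈ S)
    (hay : G.Adj a y) : y ∈ l := by
  by_contra hyl
  have hpath : IsPathIn G S (y :: a :: l) :=
    ⟨List.isChain_cons_cons.2 ⟨hay.symm, h.chain⟩,
      List.nodup_cons.2 ⟨by simp [hay.ne', hyl], h.nodup⟩,
      List.forall_mem_cons.2 ⟨hy, h.subset⟩⟩
  simpa using h.length_le _ hpath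

lemma exists_crossing {a : V} {A B : Finset V} (hA : ∀ y ∈ A, y ∈ l)
    (hB : ∀ z ∈ B, z ∈ (a :: l).dropLast) (hcard : l.length < #A + #B) :
    ∃ l₁ z y l₂, a :: l = l₁ ++ z :: y :: l₂ ∧ z ∈ B ∧ y ∈ A := by
  classical
  induction l generalizing a A B with
  | nil =>
    have hA0 : A = ∅ := eq_empty_of_forall_notMem fun y hy => by simpa using hA y hy
    have hB0 : B = ∅ := eq_empty_of_forall_notMem fun z hz => by simpa using hB z hz
    simp [hA0, hB0] at hcard
  | cons b l ih =>
    by_cases hab : a ∈ B ∧ b ∈ A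
    · exact ⟨[], a, b, l, rfl, hab⟩
    · have hcard' : l.length < #(A.erase b) + #(B.erase a) := by
        have hle : #A + #B ≤ #(A.erase b) + #(B.erase a) + 1 := by
          have hA := pred_card_le_card_erase (s := A) (a := b)
          have hB := pred_card_le_card_erase (s := B) (a := a)
          rcases not_and_or.1 hab with ha | hb
          · rw [erase_eq_of_notMem ha]
            omega
          · rw [erase_eq_of_notMem hb]
            omega
        simp only [List.length_cons] at hcard
        omega
      obtain ⟨l₁, z, y, l₂, heq, hz, hy⟩ := ih (a := b) (A := A.erase b) (B := B.erase a)
        (fun y hy => List.mem_of_ne_of_mem (ne_of_mem_erase hy) (hA y (mem_of_mem_erase hy)))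
        (fun z hz => List.mem_of_ne_of_mem (ne_of_mem_erase hz) (hB z (mem_of_mem_erase hz)))
        hcard'
      exact ⟨a :: l₁, z, y, l₂, by rw [heq, List.cons_append], mem_of_mem_erase hz,
        mem_of_mem_erase hy⟩

lemma cycle_chain_of_crossing {l₁ l₂ : List V} {z y : V} (hl : (l₁ ++ z :: y :: l₂).IsChain G.Adj)
    (hy : ∀ a ∈ (l₁ ++ [z]).head?, G.Adj y a) (hz : ∀ b ∈ (y :: l₂).getLast?, G.Adj z b) :
    Cycle.Chain G.Adj (z :: ((y :: l₂).reverse ++ l₁) : List V) := by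
  obtain ⟨hl₁, hl₂, hmid⟩ := List.isChain_append.1 hl
  have hrev : (y :: l₂).reverse.IsChain G.Adj :=
    List.isChain_reverse.2 (hl₂.tail.imp fun _ _ hadj => hadj.symm)
  have hl₁z : (l₁ ++ [z]).IsChain G.Adj := List.isChain_append.2 ⟨hl₁, by simp, by simpa using hmid⟩
  rw [Cycle.chain_coe_cons, List.append_assoc, List.isChain_cons, List.isChain_append]
  refine ⟨fun b hb => hz b ?_, hrev, hl₁z, fun u hu a ha => ?_⟩
  · rwa [List.head?_append_of_ne_nil _ (by simp), List.head?_reverse] at hb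
  · simp only [List.reverse_cons, List.getLast?_append, List.getLast?_singleton, Option.some_or,
      Option.mem_some] at hu
    exact hu ▸ hy a ha

lemma exists_isPathIn_of_cycle {c : List V} (hc : Cycle.Chain G.Adj c) (hn : c.Nodup)
    (hcS : ∀ x ∈ c, x ∈ S) {x y : V} (hx : x ∈ c) (hyS : y ∈ S) (hy : y ∉ c) (hxy : G.Adj x y) :
    ∃ l, IsPathIn G S l ∧ l.length = c.length + 1 := by
  obtain ⟨c₁, c₂, rfl⟩ := List.append_of_mem hx
  have hrot : (c₁ ++ x :: c₂).IsRotated (x :: (c₂ ++ c₁)) := List.isRotated_append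
  rw [Cycle.coe_eq_coe.2 hrot, Cycle.chain_coe_cons] at hc
  have hperm : (c₂ ++ c₁ ++ [x] ++ [y]).Perm (y :: (c₁ ++ x :: c₂)) :=
    (List.perm_append_singleton _ _).trans
      (((List.perm_append_singleton _ _).trans hrot.perm.symm).cons y)
  exact ⟨c₂ ++ c₁ ++ [x] ++ [y],
    ⟨List.isChain_append.2 ⟨hc.tail, by simp, by simpa⟩,
      hperm.nodup_iff.2 (List.nodup_cons.2 ⟨hy, hn⟩),
      fun u hu => List.forall_mem_cons.2 ⟨hyS, hcS⟩ u (hperm.subset hu)⟩,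
    by simpa using hperm.length_eq⟩

end Paths

section Components

variable {V : Type*} {G : SimpleGraph V} {S : Finset V} {P : ℕ}

lemma IsLongestPathIn.mem_of_adj_getLast {l : List V} {b y : V} (h : IsLongestPathIn G S l)
    (hb : b ∈ l.getLast?) (hy : y ∈ S) (hby : G.Adj b y) : y ∈ l.dropLast := by
  obtain ⟨l', rfl⟩ := List.getLast?_eq_some_iff.1 hb
  have hrev := h.reverse
  rw [List.reverse_append, List.reverse_singleton, List.singleton_append] at hrev
  simpa using hrev.mem_of_adj_head hy hby

/-- Ore's rotation argument: the end vertices of a longest path together have more neighbours on it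
than it has edges, so the path closes up to a cycle. -/
lemma IsLongestPathIn.exists_cycle {l : List V} (h : IsLongestPathIn G S l) (hne : l ≠ [])
    (hdeg : ∀ v ∈ S, P + 1 ≤ #(nbrs G S v)) (hlen : l.length ≤ 2 * P + 2) :
    ∃ c : List V, c.Perm l ∧ Cycle.Chain G.Adj c := by
  obtain ⟨a, l, rfl⟩ := List.exists_cons_of_ne_nil hne
  set b := (a :: l).getLast hne
  have hb : b ∈ (a :: l).getLast? := List.getLast_mem_getLast? hne
  have hcard : l.length < #(nbrs G S a) + #(nbrs G S b) := by
    have ha := hdeg a (h.subset a List.mem_cons_self)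
    have hb := hdeg b (h.subset b (List.getLast_mem hne))
    rw [List.length_cons] at hlen
    omega
  obtain ⟨l₁, z, y, l₂, heq, hz, hy⟩ := exists_crossing
    (fun y hy => h.mem_of_adj_head (mem_nbrs.1 hy).1 (mem_nbrs.1 hy).2)
    (fun z hz => h.mem_of_adj_getLast hb (mem_nbrs.1 hz).1 (mem_nbrs.1 hz).2) hcard
  refine ⟨z :: ((y :: l₂).reverse ++ l₁), ?_, cycle_chain_of_crossing (heq ▸ h.chain) ?_ ?_⟩
  · rw [heq]
    exact ((((List.reverse_perm _).append_right l₁).trans List.perm_append_comm).cons z).trans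
      List.perm_middle.symm
  · intro x hx
    have : x ∈ (a :: l).head? := by cases l₁ <;> simp_all
    obtain rfl : a = x := by simpa using this
    exact (mem_nbrs.1 hy).2.symm
  · intro x hx
    have : x ∈ (a :: l).getLast? := by rw [heq]; simpa using hx
    obtain rfl := Option.mem_unique hb this
    exact (mem_nbrs.1 hz).2.symm

lemma IsLongestPathIn.isClosedIn [DecidableEq V] {l c : List V} (h : IsLongestPathIn G S l)
    (hperm : c.Perm l) (hc : Cycle.Chain G.Adj c) : IsClosedIn G l.toFinset S where
  subset x hx := h.subset x (List.mem_toFinset.1 hx)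
  mem_of_adj x hx y hy hxy := by
    by_contra hyl
    rw [List.mem_toFinset, ← hperm.mem_iff] at hx hyl
    obtain ⟨l', hl', hlen⟩ := exists_isPathIn_of_cycle hc (hperm.nodup_iff.2 h.nodup)
      (fun x hx => h.subset x (hperm.subset hx)) hx hy hyl hxy
    have := h.length_le l' hl'
    rw [hlen, hperm.length_eq] at this
    omega

lemma exists_isClosedIn_hasMatching (hG : (pathGraph (2 * P + 3)).Free G) (hS : S.Nonempty)
    (hdeg : ∀ v ∈ S, P + 1 ≤ #(nbrs G S v)) :
    ∃ D, IsClosedIn G D S ∧ P + 2 ≤ #D ∧ #D ≤ 2 * P + 2 ∧ HasMatching G (#D / 2) D := by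
  classical
  obtain ⟨l, hl⟩ := exists_isLongestPathIn G S
  obtain ⟨v, hv⟩ := hS
  have hne : l ≠ [] := by
    rintro rfl
    simpa using hl.length_le [v] ⟨by simp, by simp, by simpa⟩
  have hlen : l.length ≤ 2 * P + 2 := length_le_of_pathGraph_free hG hl.chain hl.nodup
  obtain ⟨c, hperm, hc⟩ := hl.exists_cycle hne hdeg hlen
  have hclosed := hl.isClosedIn hperm hc
  have hcard := List.toFinset_card_of_nodup hl.nodup
  refine ⟨l.toFinset, hclosed, ?_, hcard.trans_le hlen, ?_⟩
  · obtain ⟨x, hx⟩ := List.exists_mem_of_ne_nil l hne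
    have hsub : (nbrs G S x).cons x (by simp) ⊆ l.toFinset := by
      intro y hy
      rcases mem_cons.1 hy with rfl | hy
      · exact List.mem_toFinset.2 hx
      · exact hclosed.mem_of_adj x (List.mem_toFinset.2 hx) y (mem_nbrs.1 hy).1 (mem_nbrs.1 hy).2
    have := card_le_card hsub
    rw [card_cons] at this
    have := hdeg x (hl.subset x hx)
    omega
  · rw [hcard]
    exact hasMatching_of_isChain hl.chain hl.nodup fun x hx => List.mem_toFinset.2 hx

end Components

section Core

variable {V : Type*} {G : SimpleGraph V} {S T X Z : Finset V} {P : ℕ} {t w : V}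

lemma exists_alternating_path (hTZ : G.IsCompleteBetween (T : Set V) Z) (ht : t ∈ T)
    (hTw : ∀ u ∈ T, G.Adj u w) (hw : w ∉ Z) (hcard : #T ≤ #Z + 1) :
    ∃ l : List V, (t :: (l ++ [w])).IsChain G.Adj ∧ (t :: (l ++ [w])).Nodup ∧
      l.length + 2 = 2 * #T ∧ ∀ x ∈ t :: (l ++ [w]), x ∈ T ∨ x ∈ Z ∨ x = w := by
  classical
  induction T using Finset.strongInduction generalizing t Z with
  | H T ih =>
    have herase := card_erase_add_one ht
    rcases (T.erase t).eq_empty_or_nonempty with hT' | ⟨t', ht'⟩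
    · rw [hT', card_empty] at herase
      exact ⟨[], by simpa using hTw t ht, by simpa using (hTw t ht).ne, by simp [← herase],
        by simp [ht]⟩
    · have hpos := card_pos.2 ⟨t', ht'⟩
      obtain ⟨z, hz⟩ : Z.Nonempty := card_pos.1 (by omega)
      obtain ⟨l, hl, hn, hlen, hmem⟩ := ih (T.erase t) (erase_ssubset ht) (Z := Z.erase z)
        (fun u hu y hy => hTZ (mem_of_mem_erase hu) (mem_of_mem_erase hy)) ht'
        (fun u hu => hTw u (mem_of_mem_erase hu)) (fun h => hw (mem_of_mem_erase h))
        (by rw [card_erase_of_mem hz]; omega)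
      have htz : G.Adj t z := hTZ ht hz
      have ht'z : G.Adj t' z := hTZ (mem_of_mem_erase ht') hz
      have htl : t ∉ t' :: (l ++ [w]) := fun h => by
        rcases hmem t h with h | h | rfl
        · exact notMem_erase t T h
        · exact (hTZ ht (mem_of_mem_erase h)).ne rfl
        · exact (hTw t ht).ne rfl
      have hzl : z ∉ t' :: (l ++ [w]) := fun h => by
        rcases hmem z h with h | h | rfl
        · exact (hTZ (mem_of_mem_erase h) hz).ne rfl
        · exact notMem_erase z Z h
        · exact hw hz
      refine ⟨z :: t' :: l,
        List.isChain_cons_cons.2 ⟨htz, List.isChain_cons_cons.2 ⟨ht'z.symm, hl⟩⟩,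
        List.nodup_cons.2 ⟨?_, List.nodup_cons.2 ⟨hzl, hn⟩⟩, ?_, ?_⟩
      · exact fun h => (List.mem_cons.1 h).elim htz.ne htl
      · simp only [List.length_cons]
        omega
      · refine List.forall_mem_cons.2 ⟨Or.inl ht, List.forall_mem_cons.2 ⟨Or.inr (Or.inl hz), ?_⟩⟩
        exact fun x hx => (hmem x hx).imp mem_of_mem_erase (Or.imp_left mem_of_mem_erase)

/-- A path alternating between `T` and `X` has `2 * P` vertices, so that at most two more can be
appended at its ends. -/
lemma length_add_length_le_two {p q : List V} (hG : (pathGraph (2 * P + 3)).Free G) (hT : #T = P)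
    (hTX : G.IsCompleteBetween (T : Set V) X) (hX : P + (p.length + q.length) ≤ #X) (ht : t ∈ T)
    (hTw : ∀ u ∈ T, G.Adj u w) (hp : (p ++ [t]).IsChain G.Adj) (hq : (w :: q).IsChain G.Adj)
    (hn : (p ++ w :: q).Nodup) (hpq : ∀ x ∈ p ++ q, x ∉ T) : p.length + q.length ≤ 2 := by
  classical
  have hZ := le_card_sdiff (p ++ w :: q).toFinset X
  rw [List.toFinset_card_of_nodup hn, List.length_append, List.length_cons] at hZ
  obtain ⟨l, hl, hln, hlen, hmem⟩ := exists_alternating_path (Z := X \ (p ++ w :: q).toFinset)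
    (fun u hu x hx => hTX hu (mem_sdiff.1 hx).1) ht hTw (by simp) (by omega)
  have hdisj : ∀ x ∈ p ++ q, x ∉ t :: (l ++ [w]) := fun x hx hxl => by
    rcases hmem x hxl with h | h | rfl
    · exact hpq x hx h
    · exact (mem_sdiff.1 h).2 (by simp_all)
    · exact (List.nodup_middle.1 hn).notMem hx
  have hchain : (p ++ ([t] ++ l) ++ [w] ++ q).IsChain G.Adj := by
    refine List.IsChain.append_overlap ?_ hq (by simp)
    have := hp.append_overlap hl (by simp)
    simpa using this
  have hnodup : (p ++ ([t] ++ l) ++ [w] ++ q).Nodup := by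
    have hperm : (p ++ ([t] ++ l) ++ [w] ++ q).Perm (p ++ q ++ t :: (l ++ [w])) := by
      simpa using (List.perm_append_comm (l₁ := t :: (l ++ [w])) (l₂ := q)).append_left p
    refine hperm.nodup_iff.2 (List.nodup_append'.2 ⟨(List.nodup_middle.1 hn).of_cons, hln, hdisj⟩)
  have := length_le_of_pathGraph_free hG hchain hnodup
  simp only [List.length_append, List.length_singleton] at this
  omega

lemma eq_of_adj_of_adj_core {x y z : V} (hG : (pathGraph (2 * P + 3)).Free G) (hT : #T = P)
    (hTX : G.IsCompleteBetween (T : Set V) X) (hX : P + 3 ≤ #X) (ht : t ∈ T) (hxt : G.Adj x t)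
    (hx : x ∉ T) (hxy : G.Adj x y) (hy : y ∉ T) (hyz : G.Adj y z) (hz : z ∉ T) : z = x := by
  classical
  by_contra hzx
  have hcard : #{x, y, z} ≤ 3 := card_le_three
  have hP : 0 < P := hT ▸ card_pos.2 ⟨t, ht⟩
  obtain ⟨w, hw⟩ : (X \ {x, y, z}).Nonempty :=
    card_pos.1 (by have := le_card_sdiff {x, y, z} X; omega)
  simp only [mem_sdiff, mem_insert, mem_singleton, not_or] at hw
  obtain ⟨hwX, hwx, hwy, hwz⟩ := hw
  have := length_add_length_le_two (p := [z, y, x]) (q := []) hG hT hTX (by simpa using hX) ht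
    (fun u hu => hTX hu hwX) (by simp [hyz.symm, hxy.symm, hxt]) (by simp)
    (by simp [hyz.ne', hzx, hxy.ne', Ne.symm hwx, Ne.symm hwy, Ne.symm hwz]) (by simp [hx, hy, hz])
  simp at this

lemma exists_core_partner {x : V} (hG : (pathGraph (2 * P + 3)).Free G) (hT : #T = P)
    (hTX : G.IsCompleteBetween (T : Set V) X) (hX : P + 3 ≤ #X)
    (hdeg : ∀ v ∈ S, v ∉ T → P + 1 ≤ #(nbrs G S v)) (ht : t ∈ T) (hxS : x ∈ S) (hx : x ∉ T)
    (hxt : G.Adj x t) :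
    ∃ y ∈ S, y ∉ T ∧ G.Adj x y ∧ (∀ u ∈ T, G.Adj u y) ∧ ∀ z ∉ T, G.Adj y z → z = x := by
  classical
  obtain ⟨y, hy, hyT⟩ : ∃ y ∈ nbrs G S x, y ∉ T :=
    exists_mem_notMem_of_card_lt_card (by have := hdeg x hxS hx; omega)
  obtain ⟨hyS, hxy⟩ := mem_nbrs.1 hy
  have huniq : ∀ z ∉ T, G.Adj y z → z = x := fun z hz hyz =>
    eq_of_adj_of_adj_core hG hT hTX hX ht hxt hx hxy hyT hyz hz
  have hsub : nbrs G S y ⊆ insert x (nbrs G T y) := fun z hz => by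
    by_cases hzT : z ∈ T
    · exact mem_insert_of_mem (mem_nbrs.2 ⟨hzT, (mem_nbrs.1 hz).2⟩)
    · exact mem_insert.2 (Or.inl (huniq z hzT (mem_nbrs.1 hz).2))
  have hall : nbrs G T y = T := by
    refine eq_of_subset_of_card_le (nbrs_subset T y) ?_
    have := (card_le_card hsub).trans (card_insert_le _ _)
    have := hdeg y hyS hyT
    omega
  refine ⟨y, hyS, hyT, hxy, fun u hu => ?_, huniq⟩
  rw [← hall] at hu
  exact (mem_nbrs.1 hu).2.symm

open scoped Classical in
/-- A vertex outside `T` attached to `T` has a single neighbour outside `T`; two disjoint edges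
obtained in this way would give a path on `2 * P + 3` vertices. -/
lemma exists_isClosedIn_core (hG : (pathGraph (2 * P + 3)).Free G) (hT : #T = P) (hTS : T ⊆ S)
    (hTX : G.IsCompleteBetween (T : Set V) X) (hX : P + 3 ≤ #X)
    (hdeg : ∀ v ∈ S, v ∉ T → P + 1 ≤ #(nbrs G S v)) :
    ∃ ε ≤ 1, ∃ F, Disjoint T F ∧ #F = 2 * ε ∧ HasMatching G ε F ∧
      IsClosedIn G (T ∪ F) S := by
  by_cases hattached : ∃ x ∈ S, x ∉ T ∧ ∃ t ∈ T, G.Adj x t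
  swap
  · push Not at hattached
    refine ⟨0, zero_le_one, ∅, disjoint_empty_right T, rfl, hasMatching_zero G ∅, ?_⟩
    rw [union_empty]
    exact ⟨hTS, fun t ht x hxS htx => by_contra fun hx => hattached x hxS hx t ht htx.symm⟩
  obtain ⟨x, hxS, hx, t, ht, hxt⟩ := hattached
  have partner {x t : V} := exists_core_partner (x := x) (t := t) hG hT hTX hX hdeg
  obtain ⟨y, hyS, hy, hxy, hyT, hy_uniq⟩ := partner ht hxS hx hxt
  obtain ⟨x', hx'S, hx', hyx', -, hx_uniq⟩ := partner ht hyS hy (hyT t ht).symm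
  obtain rfl : x' = x := hy_uniq x' hx' hyx'
  have hclosed : ∀ v ∈ S, v ∉ T → v ≠ x' → v ≠ y → ∀ u ∈ T, ¬ G.Adj v u := by
    intro v hvS hv hvx hvy u hu hvu
    obtain ⟨z, -, -, hvz, hzT, -⟩ := partner hu hvS hv hvu
    have hzx : z ≠ x' := by rintro rfl; exact hvy (hx_uniq v hv hvz.symm)
    have hzy : z ≠ y := by rintro rfl; exact hvx (hy_uniq v hv hvz.symm)
    have := length_add_length_le_two (p := [y, x']) (q := [v]) hG hT hTX (by simpa using hX) ht hzT
      (by simp [hxy.symm, hxt]) (by simp [hvz.symm])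
      (by simp [hyx'.ne, hzx.symm, hzy.symm, hvx.symm, hvy.symm, hvz.ne']) (by simp [hx, hy, hv])
    simp at this
  refine ⟨1, le_rfl, {x', y}, by simp [hx, hy],
    card_pair hxy.ne, ⟨x', by simp, y, by simp, hxy, ∅, by simp, by simp, by simp, trivial⟩,
    union_subset hTS (by simp [insert_subset_iff, hxS, hyS]), fun u hu v hvS huv => ?_⟩
  by_contra hv
  simp only [mem_union, mem_insert, mem_singleton, not_or] at hu hv
  obtain ⟨hvT, hvx, hvy⟩ := hv
  rcases hu with hu | rfl | rfl
  · exact hclosed v hvS hvT hvx hvy u hu huv.symm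
  · exact hvy (hx_uniq v hvT huv)
  · exact hvx (hy_uniq v hvT huv)

end Core

/-- `M` is at least the total gain over `gain P k P` in each of `G₃, …, G₆` with `p = P + 1`. -/
abbrev DominatesGains (P k c d : ℕ) (M : ℤ) : Prop :=
  Dominates P c d (gain P k (2 * P + 2)) (P.choose k) (fun j => gain P k (lastOrder j)) M

/-- The family whose members are the path on `m` vertices and the matching of size `k`. -/
abbrev pathOrMatching (m k : ℕ) : Set (Σ V : Type, SimpleGraph V) :=
  {⟨_, pathGraph m⟩, ⟨_, matching k⟩}

section UpperBound

variable {V : Type*} {G : SimpleGraph V} {P : ℕ}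

lemma exists_clique_union_bound (k : ℕ) (hP : 1 ≤ P) (hG : (pathGraph (2 * P + 3)).Free G)
    (S : Finset V) (hdeg : ∀ v ∈ S, P + 1 ≤ #(nbrs G S v)) :
    ∃ a b j : ℕ, j ≤ P ∧ HasMatching G (a * (P + 1) + b * P + j) S ∧
      excess G P k S ≤
        a * gain P k (2 * P + 2) + b * gain P k (lastOrder P) + gain P k (lastOrder j) := by
  classical
  induction S using Finset.strongInduction with
  | H S ih =>
    rcases S.eq_empty_or_nonempty with rfl | hS
    · exact ⟨0, 0, 0, Nat.zero_le P, by simpa using hasMatching_zero G ∅, by simp [gain_zero]⟩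
    · obtain ⟨D, hD, hDcard, hDcard', hDmatch⟩ := exists_isClosedIn_hasMatching hG hS hdeg
      have hDne : D.Nonempty := card_pos.1 (by omega)
      obtain ⟨a, b, j, hj, hmatch, hexcess⟩ := ih (S \ D) (sdiff_ssubset hD.subset hDne)
        fun v hv => (hdeg v (mem_sdiff.1 hv).1).trans
          (card_le_card (hD.nbrs_subset_nbrs_sdiff hv))
      obtain ⟨a', b', j', hj', hcost, hgain⟩ :=
        exists_cost_add_clique k hP hDcard hDcard' a b hj
      refine ⟨a', b', j', hj', ?_, ?_⟩
      · exact hcost ▸ hmatch.add hDmatch sdiff_disjoint sdiff_subset hD.subset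
      · linarith [hD.excess_le P k, excess_le_gain (G := G) P k D]

lemma gain_add_two_mul {k ε : ℕ} (hε : ε ≤ 1) :
    gain P k (P + 2 * ε) = gain P k P + ε * (P.choose k : ℤ) := by
  interval_cases ε
  · simp
  · simpa using gain_add_two_self P k

lemma excess_le_of_core [Fintype V] {k c d : ℕ} {T X : Finset V} {M : ℤ} (hP : 1 ≤ P)
    (hG : (pathGraph (2 * P + 3)).Free G)
    (hmatch : ¬ HasMatching G (P + (c * (P + 1) + d) + 1) univ) (hT : #T = P)
    (hTX : G.IsCompleteBetween (T : Set V) X) (hX : P + 3 ≤ #X) (hd : d ≤ P)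
    (hM : DominatesGains P k c d M) :
    excess G P k univ ≤ gain P k P + M := by
  classical
  obtain ⟨S, hTS, hdeg, hpeel⟩ := exists_peeled (G := G) P k T univ (subset_univ T)
  obtain ⟨ε, hε, F, hTF, hFcard, hFmatch, hclosed⟩ :=
    exists_isClosedIn_core hG hT hTS hTX hX hdeg
  obtain ⟨a, b, j, hj, hRmatch, hRexcess⟩ := exists_clique_union_bound k hP hG (S \ (T ∪ F))
    fun v hv => (hdeg v (mem_sdiff.1 hv).1 fun hvT =>
      (mem_sdiff.1 hv).2 (mem_union_left F hvT)).trans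
        (card_le_card (hclosed.nbrs_subset_nbrs_sdiff hv))
  have hTmatch : HasMatching G P (T ∪ X \ F) := by
    have := le_card_sdiff F X
    exact hT ▸ hasMatching_of_isCompleteBetween (fun t ht x hx => hTX ht (mem_sdiff.1 hx).1)
      (by omega) subset_union_left subset_union_right
  have hdisj : Disjoint (T ∪ X \ F ∪ F) (S \ (T ∪ F)) := by
    obtain ⟨t, ht⟩ : T.Nonempty := card_pos.1 (by omega)
    refine Finset.disjoint_left.2 fun v hv hvR => ?_
    obtain ⟨hvS, hvTF⟩ := mem_sdiff.1 hvR
    refine hvTF ?_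
    simp only [mem_union, mem_sdiff] at hv
    rcases hv with (hvT | hvX) | hvF
    · exact mem_union_left F hvT
    · exact hclosed.mem_of_adj t (mem_union_left F ht) v hvS (hTX ht hvX.1)
    · exact mem_union_right T hvF
  have hall : HasMatching G (P + ε + (a * (P + 1) + b * P + j)) univ :=
    (hTmatch.add hFmatch (disjoint_union_left.2 ⟨hTF, sdiff_disjoint⟩) subset_union_left
      subset_union_right).add hRmatch hdisj (subset_univ _) (subset_univ _)
  have hcost : a * (P + 1) + b * P + j + ε ≤ c * (P + 1) + d := by
    by_contra hlt
    exact hmatch (hall.of_le (by omega))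
  have hcomponent := excess_le_gain (G := G) P k (T ∪ F)
  rw [card_union_of_disjoint hTF, hT, hFcard, gain_add_two_mul hε] at hcomponent
  have := (gainSystem k hP).le_of_cost_le hM hd hj hε hcost
  linarith [hclosed.excess_le P k]

lemma cliqueCount_le_of_degree_le (r : ℕ) {m : ℕ} {U S : Finset V} (hUS : U ⊆ S)
    (hdeg : ∀ v ∈ S, v ∉ U → #(nbrs G S v) ≤ m) :
    cliqueCount G (r + 1) S ≤ cliqueCount G (r + 1) U + #S * m.choose r := by
  classical
  induction S using Finset.strongInduction with
  | H S ih =>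
    rcases hUS.eq_or_ssubset with rfl | hlt
    · exact Nat.le_add_right _ _
    · obtain ⟨v, hv, hvU⟩ := exists_of_ssubset hlt
      have hsub := erase_subset v S
      have hrec := ih (S.erase v) (erase_ssubset hv) (subset_erase.2 ⟨hUS, hvU⟩)
        fun u hu huU => (card_le_card (nbrs_subset_nbrs hsub u)).trans (hdeg u (hsub hu) huU)
      have hcount := cliqueCount_cons (G := G) r (notMem_erase v S)
      have hlink := (cliqueCount_le_choose (G := G) r (nbrs G (S.erase v) v)).trans
        (Nat.choose_le_choose r ((card_le_card (nbrs_subset_nbrs hsub v)).trans (hdeg v hv hvU)))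
      rw [cons_eq_insert, insert_erase hv] at hcount
      rw [← card_erase_add_one hv, Nat.succ_mul]
      omega

open scoped Classical in
lemma card_le_of_no_core {B : ℕ} (U S : Finset V)
    (hB : ∀ T X : Finset V, #T = P → G.IsCompleteBetween (T : Set V) X → #X ≤ B) :
    #{v ∈ S | P ≤ #(nbrs G U v)} ≤ (#U).choose P * B := by
  have hcover : {v ∈ S | P ≤ #(nbrs G U v)} ⊆
      (U.powersetCard P).biUnion fun T => {v ∈ S | ∀ t ∈ T, G.Adj t v} := by
    intro v hv
    obtain ⟨hvS, hcard⟩ := mem_filter.1 hv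
    obtain ⟨T, hTsub, hTcard⟩ := exists_subset_card_eq hcard
    exact mem_biUnion.2 ⟨T, mem_powersetCard.2 ⟨hTsub.trans (nbrs_subset U v), hTcard⟩,
      mem_filter.2 ⟨hvS, fun t ht => (mem_nbrs.1 (hTsub ht)).2.symm⟩⟩
  refine (card_le_card hcover).trans ((card_biUnion_le_card_mul _ _ B fun T hT => ?_).trans ?_)
  · exact hB T _ (mem_powersetCard.1 hT).2 fun t ht x hx => (mem_filter.1 hx).2 t ht
  · rw [card_powersetCard]

lemma cliqueCount_le_of_no_core [Fintype V] {s B : ℕ} (r : ℕ) (hP : 1 ≤ P)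
    (hmatch : ¬ HasMatching G (s + 1) univ)
    (hB : ∀ T X : Finset V, #T = P → G.IsCompleteBetween (T : Set V) X → #X ≤ B) :
    cliqueCount G (r + 1) univ ≤
      (2 * s + (2 * s).choose P * B).choose (r + 1) + Fintype.card V * (P - 1).choose r := by
  classical
  obtain ⟨U, hU, hindep⟩ := exists_cover_of_not_hasMatching hmatch
  set W : Finset V := {v | P ≤ #(nbrs G U v)} with hW
  have hcard : #(U ∪ W) ≤ 2 * s + (2 * s).choose P * B :=
    (card_union_le _ _).trans (add_le_add hU ((card_le_of_no_core U univ hB).trans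
      (Nat.mul_le_mul_right B (Nat.choose_le_choose P hU))))
  refine (cliqueCount_le_of_degree_le r (subset_univ (U ∪ W)) fun v _ hv => ?_).trans
    (Nat.add_le_add_right ((cliqueCount_le_choose _ _).trans (Nat.choose_le_choose _ hcard)) _)
  simp only [hW, mem_union, mem_filter, mem_univ, true_and, not_or, not_le] at hv
  obtain ⟨hvU, hdeg⟩ := hv
  have hsub : nbrs G univ v ⊆ nbrs G U v := fun u hu => mem_nbrs.2
    ⟨by_contra fun huU => hindep v (mem_univ v) u (mem_univ u) hvU huU (mem_nbrs.1 hu).2,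
      (mem_nbrs.1 hu).2⟩
  have := card_le_card hsub
  omega

lemma eventually_ex_le {k c d : ℕ} (hP : 1 ≤ P) (hk : k + 1 ≤ P) (hd : d ≤ P) :
    ∀ᶠ n : ℕ in Filter.atTop, ∀ N : ℕ,
      DominatesGains P k c d (N - n * (P.choose (k + 1) : ℤ) - gain P k P) →
      ex n (K (k + 2)) (pathOrMatching (2 * P + 3) (P + (c * (P + 1) + d) + 1)) ≤ N := by
  classical
  set s := P + (c * (P + 1) + d)
  set m : ℕ := (2 * s + (2 * s).choose P * (P + 2)).choose (k + 2)
  filter_upwards [Filter.eventually_ge_atTop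
    (m - gain P k P - (c * gain P k (2 * P + 2) + gain P k (lastOrder d))).toNat]
    with n hn N hN
  refine Finset.sup_le fun G hG => ?_
  have hfree := (mem_filter.1 hG).2
  have hpath : (pathGraph (2 * P + 3)).Free G := hfree _ (Or.inl rfl)
  have hmatch : ¬ HasMatching G (s + 1) univ := fun h =>
    hfree _ (Or.inr rfl) (hasMatching_univ_iff.1 h)
  rw [copyCount_eq_cliqueCount]
  by_cases hcore : ∀ T X : Finset (Fin n), #T = P → G.IsCompleteBetween (T : Set (Fin n)) X →
      #X ≤ P + 2
  · have hcount := cliqueCount_le_of_no_core (k + 1) hP hmatch hcore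
    have hchoose : (P - 1).choose (k + 1) + 1 ≤ P.choose (k + 1) := by
      obtain ⟨P, rfl⟩ := Nat.exists_eq_add_of_le' hP
      have := Nat.choose_pos (show k ≤ P by omega)
      rw [Nat.choose_succ_succ' P, Nat.add_sub_cancel]
      omega
    have hmul := Nat.mul_le_mul_left n hchoose
    have hfour := hN.four
    rw [Int.toNat_le] at hn
    rw [Fintype.card_fin] at hcount
    zify at *
    linarith
  · push Not at hcore
    obtain ⟨T, X, hT, hTX, hX⟩ := hcore
    have hexcess := excess_le_of_core hP hpath hmatch hT hTX hX hd hN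
    rw [excess, card_univ, Fintype.card_fin] at hexcess
    zify
    linarith

lemma ex_eq_zero {r m k n : ℕ} (h : m ≤ r) : ex n (K r) (pathOrMatching m k) = 0 := by
  classical
  refine Nat.le_zero.1 (Finset.sup_le fun G hG => (copyCount_eq_zero.2 fun hK => ?_).le)
  refine (mem_filter.1 hG).2 _ (Or.inl rfl) (IsContained.trans ?_ hK)
  exact ⟨⟨⟨Fin.castLE h, fun hadj => (Fin.castLE_injective h).ne hadj.ne⟩, Fin.castLE_injective h⟩⟩

end UpperBound

section Constructions

variable {V W : Type*} {G : SimpleGraph V} {H : SimpleGraph W} {P k ν μ : ℕ} {x y : ℤ}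

lemma length_le_two_mul_countP_isLeft_add_one {l : List (V ⊕ W)}
    (hl : l.IsChain fun a b => a.isLeft ∨ b.isLeft) : l.length ≤ 2 * l.countP Sum.isLeft + 1 := by
  match l with
  | [] | [_] => simp
  | a :: b :: l =>
    have := length_le_two_mul_countP_isLeft_add_one (l := l) hl.tail.tail
    rcases (List.isChain_cons_cons.1 hl).1 with h | h <;>
      simp only [List.length_cons, List.countP_cons, h, if_true] <;> omega

lemma length_le_two_mul_countP_isLeft_add_two (hH : H.edgeSet.Subsingleton) {l : List (V ⊕ W)}
    (hl : l.IsChain (join G H).Adj) (hn : l.Nodup) :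
    l.length ≤ 2 * l.countP Sum.isLeft + 2 := by
  by_cases hright : l.IsChain fun a b => a.isLeft ∨ b.isLeft
  · exact (length_le_two_mul_countP_isLeft_add_one hright).trans (Nat.le_succ _)
  simp only [List.isChain_iff_forall_rel_of_append_cons_cons, not_forall] at hright
  obtain ⟨a, b, l₁, l₂, rfl, hab⟩ := hright
  obtain ⟨⟨u, rfl⟩, v, rfl⟩ : (∃ u, a = .inr u) ∧ ∃ v, b = .inr v := by
    simpa [← Sum.isRight_iff] using hab
  have hsplit : l₁ ++ .inr u :: .inr v :: l₂ = (l₁ ++ [.inr u]) ++ .inr v :: l₂ := by simp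
  rw [hsplit] at hl hn ⊢
  have huv : H.Adj u v := (List.isChain_append.1 hl).2.2 (.inr u) (by simp) (.inr v) (by simp)
  have hchain {l' : List (V ⊕ W)} (hl' : l'.IsChain (join G H).Adj)
      (huv' : ¬ (.inr u ∈ l' ∧ .inr v ∈ l')) : l'.IsChain fun a b => a.isLeft ∨ b.isLeft := by
    refine hl'.imp_of_mem_imp fun a b ha hb hab => ?_
    rcases a with a | a <;> rcases b with b | b <;> simp only [Sum.isLeft, true_or, or_true]
    rcases Sym2.eq_iff.1 (hH (mem_edgeSet H |>.2 hab) (mem_edgeSet H |>.2 huv)) with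
      ⟨rfl, rfl⟩ | ⟨rfl, rfl⟩
    · exact absurd ⟨ha, hb⟩ huv'
    · exact absurd ⟨hb, ha⟩ huv'
  have hdisj := List.disjoint_of_nodup_append hn
  have h₁ := length_le_two_mul_countP_isLeft_add_one
    (hchain hl.left_of_append fun h => hdisj h.2 (by simp))
  have h₂ := length_le_two_mul_countP_isLeft_add_one
    (hchain hl.right_of_append fun h => hdisj (by simp) h.1)
  rw [List.length_append, List.countP_append]
  omega

lemma pathGraph_free_join [Fintype V] (hV : Fintype.card V = P) (hH : H.edgeSet.Subsingleton) :
    (pathGraph (2 * P + 3)).Free (join G H) := by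
  rw [Free, pathGraph_isContained_iff]
  rintro ⟨l, hl, hn, hlen⟩
  have hleft : l.countP Sum.isLeft ≤ P := by
    have : (l.filterMap Sum.getLeft?).Nodup := hn.filterMap fun a b c ha hb => by
      rw [Sum.getLeft?_eq_some_iff.1 ha, Sum.getLeft?_eq_some_iff.1 hb]
    refine le_trans (le_of_eq ?_) (this.length_le_card.trans_eq hV)
    rw [List.length_filterMap_eq_countP]
    exact List.countP_congr fun a _ => by cases a <;> rfl
  have := length_le_two_mul_countP_isLeft_add_two hH hl hn
  omega

lemma isContained_of_forall_mem_range {U : Type*} {F : SimpleGraph U} (f : Copy F H) (e : G ↪g H)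
    (hf : ∀ u, ∃ v, f u = e v) : F ⊑ G := by
  choose g hg using hf
  refine ⟨⟨⟨g, fun {u v} huv => ?_⟩, fun u v huv => f.injective ?_⟩⟩
  · rw [← e.map_adj_iff, ← hg, ← hg]
    exact f.toHom.map_adj huv
  · exact (hg u).trans ((congrArg e huv).trans (hg v).symm)

lemma free_sum {U : Type*} {F : SimpleGraph U} (hF : F.Connected) (hG : F.Free G)
    (hH : F.Free H) : F.Free (G ⊕g H) := by
  rintro ⟨f⟩
  obtain ⟨r⟩ := hF.nonempty
  have hreach (u) : (G ⊕g H).Reachable (f r) (f u) := (hF.preconnected r u).map f.toHom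
  rcases hr : f r with a | a <;> simp only [hr] at hreach
  · refine hG (isContained_of_forall_mem_range f Embedding.sumInl fun u => ?_)
    rcases hu : f u with b | b
    · exact ⟨b, rfl⟩
    · exact absurd (hu ▸ hreach u) (not_reachable_sum_inl_inr a b)
  · refine hH (isContained_of_forall_mem_range f Embedding.sumInr fun u => ?_)
    rcases hu : f u with b | b
    · exact absurd (hu ▸ hreach u).symm (not_reachable_sum_inl_inr b a)
    · exact ⟨b, rfl⟩

/-- `k + 1` copies of `H` are one copy and `k` further copies. -/
def copiesSuccIso (k : ℕ) (H : SimpleGraph W) : copies (k + 1) H ≃g H ⊕g copies k H where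
  toFun x := Fin.cases (.inl x.2) (fun i => .inr (i, x.2)) x.1
  invFun := Sum.elim (fun w => (0, w)) fun x => (x.1.succ, x.2)
  left_inv := by
    rintro ⟨i, w⟩
    induction i using Fin.cases <;> rfl
  right_inv := by rintro (w | ⟨i, w⟩) <;> rfl
  map_rel_iff' := by
    rintro ⟨i, w⟩ ⟨j, w'⟩
    induction i using Fin.cases <;> induction j using Fin.cases <;>
      simp [copies, Fin.succ_ne_zero, (Fin.succ_ne_zero _).symm]

lemma excess_le_excess_of_subset (k : ℕ) {S S' T : Finset V} (hSS' : S ⊆ S')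
    (hT : G.IsClique (T : Set V)) (hcard : #T = P) (hTS : T ⊆ S)
    (hadj : ∀ v ∉ S, ∀ t ∈ T, G.Adj v t) : excess G P k S ≤ excess G P k S' := by
  classical
  induction S' using Finset.strongInduction with
  | H S' ih =>
    rcases hSS'.eq_or_ssubset with rfl | hlt
    · exact le_rfl
    · obtain ⟨v, hv, hvS⟩ := exists_of_ssubset hlt
      have hsub := subset_erase.2 ⟨hSS', hvS⟩
      have := excess_le_excess_cons k (notMem_erase v S') hT hcard
        fun t ht => mem_nbrs.2 ⟨hsub (hTS ht), hadj v hvS t ht⟩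
      rw [cons_eq_insert, insert_erase hv] at this
      exact (ih _ (erase_ssubset hv) hsub).trans this

lemma gain_le_excess_join [Fintype W] (P k : ℕ) {C : Finset W} (hC : H.IsClique (C : Set W)) :
    gain P k (P + #C) ≤ excess (join (K P) H) P k univ := by
  classical
  have hclique : (join (K P) H).IsClique ((univ.disjSum C : Finset (Fin P ⊕ W)) : Set _) := by
    rintro (a | a) ha (b | b) hb hab
    · exact fun h => hab (congrArg _ h)
    · trivial
    · trivial
    · exact hC (by simpa using ha) (by simpa using hb) fun h => hab (congrArg _ h)
  have hT : univ.map .inl ⊆ (univ.disjSum C : Finset (Fin P ⊕ W)) := by simp [subset_iff]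
  rw [← Fintype.card_fin P, ← card_univ, ← card_disjSum, card_univ, Fintype.card_fin,
    ← excess_eq_gain P k hclique]
  refine excess_le_excess_of_subset k (subset_univ _) (hclique.subset (coe_subset.2 hT))
    (by simp) hT ?_
  rintro (a | a) ha t ht
  · simp at ha
  · obtain ⟨b, -, rfl⟩ := mem_map.1 ht
    trivial

lemma not_hasMatching_bot (k : ℕ) (S : Finset V) : ¬ HasMatching ⊥ (k + 1) S :=
  fun ⟨_, _, _, _, h, _⟩ => h

lemma not_hasMatching_card_div_two [Fintype V] (G : SimpleGraph V) :
    ¬ HasMatching G (Fintype.card V / 2 + 1) univ := fun h => by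
  have := h.two_mul_le_card
  rw [card_univ] at this
  omega

lemma not_hasMatching_sum [Fintype V] [Fintype W] (hG : ¬ HasMatching G (ν + 1) univ)
    (hH : ¬ HasMatching H (μ + 1) univ) : ¬ HasMatching (G ⊕g H) (ν + μ + 1) univ := by
  intro h
  obtain ⟨i, j, hij, hi, hj⟩ := h.of_sum
  rw [toLeft_univ] at hi
  rw [toRight_univ] at hj
  rcases Nat.lt_or_ge ν i with hlt | hle
  · exact hG (hi.of_le hlt)
  · exact hH (hj.of_le (by omega))

/-- `G` contains neither a path on `2 P + 3` vertices nor a matching of size `ν + 1`, and its excess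
is at least `x`. -/
structure Realizes [Fintype V] (G : SimpleGraph V) (P k ν : ℕ) (x : ℤ) : Prop where
  path_free : (pathGraph (2 * P + 3)).Free G
  not_hasMatching : ¬ HasMatching G (ν + 1) univ
  le_excess : x ≤ excess G P k univ

namespace Realizes

lemma congr [Fintype V] [Fintype W] (h : Realizes G P k ν x) (e : G ≃g H) :
    Realizes H P k ν x where
  path_free := (free_congr_right e).1 h.path_free
  not_hasMatching := by
    rw [hasMatching_univ_iff, ← isContained_congr_right e, ← hasMatching_univ_iff]
    exact h.not_hasMatching
  le_excess := by
    have := excess_map e.toEmbedding P k univ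
    rw [show univ.map e.toEmbedding.toEmbedding = univ from map_univ_equiv e.toEquiv] at this
    exact this ▸ h.le_excess

lemma sum [Fintype V] [Fintype W] (hG : Realizes G P k ν x) (hH : Realizes H P k μ y) :
    Realizes (G ⊕g H) P k (ν + μ) (x + y) where
  path_free := free_sum (pathGraph_connected _) hG.path_free hH.path_free
  not_hasMatching := not_hasMatching_sum hG.not_hasMatching hH.not_hasMatching
  le_excess := by
    have hleft : excess (G ⊕g H) P k (univ.map .inl) = excess G P k univ :=
      excess_map Embedding.sumInl P k univ
    have hright : excess (G ⊕g H) P k (univ.map .inr) = excess H P k univ :=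
      excess_map Embedding.sumInr P k univ
    refine (add_le_add hG.le_excess hH.le_excess).trans ?_
    rw [← hleft, ← hright]
    exact excess_add_le_disjUnion P k (disjoint_map_inl_map_inr univ univ)

lemma of_isEmpty [Fintype V] [IsEmpty V] (G : SimpleGraph V) (P k : ℕ) : Realizes G P k 0 0 where
  path_free := by
    rintro ⟨f⟩
    exact isEmptyElim (f 0)
  not_hasMatching h := by simpa using h.two_mul_le_card
  le_excess := by rw [univ_eq_empty, excess_empty]

lemma complete (P k : ℕ) {m : ℕ} (hm : m ≤ 2 * P + 2) :
    Realizes (K m) P k (m / 2) (gain P k m) where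
  path_free := by
    rintro ⟨f⟩
    have := Fintype.card_le_of_injective f f.injective
    simp only [Fintype.card_fin] at this
    omega
  not_hasMatching := by simpa only [Fintype.card_fin] using not_hasMatching_card_div_two (K m)
  le_excess := by
    rw [excess_eq_gain P k fun _ _ _ _ h => h, card_univ, Fintype.card_fin]

lemma copies [Fintype V] (hG : Realizes G P k ν x) (q : ℕ) :
    Realizes (copies q G) P k (q * ν) (q * x) := by
  induction q with
  | zero => simpa using of_isEmpty (BoundedMatching.copies 0 G) P k
  | succ q ih =>
    have := (hG.sum ih).congr (copiesSuccIso q G).symm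
    convert this using 1
    · ring
    · push_cast; ring

lemma join [Fintype W] (P k : ℕ) (hedge : H.edgeSet.Subsingleton)
    (hH : ¬ HasMatching H (ν + 1) univ) {C : Finset W} (hC : H.IsClique (C : Set W)) :
    Realizes (join (K P) H) P k (P + ν) (gain P k (P + #C)) where
  path_free := pathGraph_free_join (Fintype.card_fin P) hedge
  not_hasMatching h := by
    obtain ⟨i, j, hij, hi, hj⟩ := h.of_join
    rw [toLeft_univ, card_univ, Fintype.card_fin] at hi
    rw [toRight_univ] at hj
    exact hH (hj.of_le (by omega))
  le_excess := gain_le_excess_join P k hC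

lemma join_edgeless (P k m : ℕ) :
    Realizes (BoundedMatching.join (K P) (I m)) P k P (gain P k P) :=
  join (ν := 0) (C := ∅) P k (by simp) (not_hasMatching_bot 0 univ) (by simp)

lemma join_edge (P k m : ℕ) : Realizes (BoundedMatching.join (K P) (K 2 ⊕g I m)) P k (P + 1)
    (gain P k P + P.choose k) := by
  rw [← gain_add_two_self]
  have hclique : (K 2 ⊕g I m).IsClique (({.inl 0, .inl 1} : Finset (Fin 2 ⊕ Fin m)) : Set _) := by
    simp
  have hedge : ∀ e ∈ (K 2 ⊕g I m).edgeSet, e = s(.inl 0, .inl 1) := by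
    rintro ⟨a | a, b | b⟩ h
    · fin_cases a <;> fin_cases b <;> simp_all [Sym2.eq_swap]
    all_goals simp at h
  exact join P k (fun e he e' he' => (hedge e he).trans (hedge e' he').symm)
    (not_hasMatching_sum (not_hasMatching_card_div_two (K 2)) (not_hasMatching_bot 0 univ)) hclique

lemma le_copyCount [Fintype V] (h : Realizes G P k ν x) :
    Fintype.card V * (P.choose (k + 1) : ℤ) + x ≤ G.copyCount (K (k + 2)) := by
  have := h.le_excess
  rw [excess, card_univ] at this
  rw [copyCount_eq_cliqueCount]
  linarith

lemma copyCount_le_ex {V : Type} [Fintype V] {G : SimpleGraph V} (h : Realizes G P k ν x)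
    {s : ℕ} (hν : ν ≤ s) (r : ℕ) : G.copyCount (K r) ≤
      ex (Fintype.card V) (K r) (pathOrMatching (2 * P + 3) (s + 1)) := by
  classical
  let e : G ≃g G.map (Fintype.equivFin V).toEmbedding := Iso.map (Fintype.equivFin V) G
  have he := h.congr e
  calc G.copyCount (K r) = cliqueCount (G.map (Fintype.equivFin V).toEmbedding) r
        (univ.map e.toEmbedding.toEmbedding) := by
          rw [copyCount_eq_cliqueCount, cliqueCount_map]
    _ ≤ (G.map (Fintype.equivFin V).toEmbedding).copyCount (K r) := by
          rw [copyCount_eq_cliqueCount]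
          exact cliqueCount_mono r (subset_univ _)
    _ ≤ _ := Finset.le_sup (f := fun G : SimpleGraph (Fin _) => G.copyCount (K r))
          (mem_filter.2 ⟨mem_univ _, ?_⟩)
  rintro F (rfl | rfl)
  · exact he.path_free
  · exact fun hm => he.not_hasMatching ((hasMatching_univ_iff.2 hm).of_le (by omega))

end Realizes

end Constructions

section Attained

open Filter

/-- `N` is a lower bound for the number of copies of `K_{k+2}` in an extremal graph on `n` vertices
and, compared with `P.choose (k + 1)` copies for each vertex, has a surplus of at least
`gain P k P + x`; the first summand is the share of the clique `K_P` of `K_P ∨ I_m`. -/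
structure AttainsGain (P k s n : ℕ) (x : ℤ) (N : ℕ) : Prop where
  le_count : n * (P.choose (k + 1) : ℤ) + gain P k P + x ≤ N
  count_le_ex : N ≤ ex n (K (k + 2)) (pathOrMatching (2 * P + 3) (s + 1))

variable {P k s n ν : ℕ} {x y : ℤ}

lemma Realizes.attainsGain {V : Type} [Fintype V] {G : SimpleGraph V}
    (h : Realizes G P k ν y) (hV : Fintype.card V = n) (hν : ν ≤ s) (hy : gain P k P + x = y) :
    AttainsGain P k s n x (G.copyCount (K (k + 2))) where
  le_count := by simpa only [hV, ← hy, add_assoc] using h.le_copyCount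
  count_le_ex := hV ▸ h.copyCount_le_ex hν (k + 2)

lemma lastOrder_div_two (j : ℕ) : lastOrder j / 2 = j := by
  unfold lastOrder; split_ifs <;> omega

lemma realizes_lastOrder (k : ℕ) {j : ℕ} (hj : j ≤ P) :
    Realizes (K (lastOrder j)) P k j (gain P k (lastOrder j)) := by
  have := Realizes.complete P k (m := lastOrder j) (by unfold lastOrder; split_ifs <;> omega)
  rwa [lastOrder_div_two] at this

lemma realizes_even (P k : ℕ) : Realizes (K (2 * P + 2)) P k (P + 1) (gain P k (2 * P + 2)) := by
  have := Realizes.complete P k (le_refl (2 * P + 2))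
  rwa [show (2 * P + 2) / 2 = P + 1 by omega] at this

lemma realizes_odd (k : ℕ) (hP : 1 ≤ P) :
    Realizes (K (2 * P + 1)) P k P (gain P k (lastOrder P)) := by
  have := realizes_lastOrder k (le_refl P)
  rwa [lastOrder_of_pos hP] at this ⊢

variable (k c d : ℕ)

lemma eventually_attainsGain_G₃ (hP : 1 ≤ P) (hcd : 1 ≤ c * (P + 1) + d) : ∀ᶠ n in atTop,
    AttainsGain P k (P + (c * (P + 1) + d)) n
      (((c * (P + 1) + d) / P : ℕ) * gain P k (lastOrder P) +
        gain P k (lastOrder ((c * (P + 1) + d) % P)))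
      ((G₃ n (P + (c * (P + 1) + d)) (P + 1)).copyCount (K (k + 2))) := by
  generalize c * (P + 1) + d = u at hcd ⊢
  have hq : (P + u - (P + 1) + 1) / (P + 1 - 1) = u / P := by
    congr 1
    omega
  have ht : P + u - ((P + u - (P + 1) + 1) / (P + 1 - 1) + 1) * (P + 1 - 1) = u % P := by
    have := Nat.div_add_mod u P
    rw [hq, Nat.add_sub_cancel, Nat.add_mul, Nat.mul_comm]
    omega
  filter_upwards [eventually_ge_atTop (P + u / P * (2 * P + 1) + lastOrder (u % P))] with n hn
  have hreal := ((Realizes.join_edgeless P k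
    (n - (P + u / P * (2 * P + 1) + lastOrder (u % P)))).sum
    ((realizes_odd k hP).copies (u / P))).sum (realizes_lastOrder k (Nat.mod_lt u hP).le)
  unfold G₃
  dsimp only
  rw [ht, hq]
  refine hreal.attainsGain ?_ ?_ (add_assoc _ _ _).symm
  · simp only [Fintype.card_sum, Fintype.card_prod, Fintype.card_fin]
    omega
  · rw [add_assoc, Nat.div_add_mod']

lemma eventually_attainsGain_G₄ (hd : d ≤ P) : ∀ᶠ n in atTop,
    AttainsGain P k (P + (c * (P + 1) + d)) n
      (c * gain P k (2 * P + 2) + gain P k (lastOrder d))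
      ((G₄ n (P + 1) c d).copyCount (K (k + 2))) := by
  filter_upwards [eventually_ge_atTop (P + c * (2 * P + 2) + lastOrder d)] with n hn
  have hreal := ((Realizes.join_edgeless P k (n - (P + c * (2 * P + 2) + lastOrder d))).sum
    ((realizes_even P k).copies c)).sum (realizes_lastOrder k hd)
  refine hreal.attainsGain ?_ (add_assoc _ _ _).le (add_assoc _ _ _).symm
  simp only [Fintype.card_sum, Fintype.card_prod, Fintype.card_fin]
  omega

lemma eventually_attainsGain_G₅ (hP : 1 ≤ P) (hd : d ≤ P) (hcd : P ≤ c + d) : ∀ᶠ n in atTop,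
    AttainsGain P k (P + (c * (P + 1) + d)) n
      ((c + d - P : ℕ) * gain P k (2 * P + 2) + (P + 1 - d : ℕ) * gain P k (lastOrder P))
      ((G₅ n (P + 1) c d).copyCount (K (k + 2))) := by
  filter_upwards [eventually_ge_atTop (P + (c + d - P) * (2 * P + 2) +
    (P + 1 - d) * (2 * P + 1))] with n hn
  have hreal := ((Realizes.join_edgeless P k
    (n - (P + (c + d - P) * (2 * P + 2) + (P + 1 - d) * (2 * P + 1)))).sum
    ((realizes_even P k).copies (c + d - P))).sum ((realizes_odd k hP).copies (P + 1 - d))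
  have hedges : P + (c + d - P) * (P + 1) + (P + 1 - d) * P = P + (c * (P + 1) + d) := by
    zify [hcd, hd.trans (Nat.le_succ P)]
    ring
  unfold G₅
  rw [show c + d + 1 - (P + 1) = c + d - P by omega]
  refine hreal.attainsGain ?_ hedges.le (add_assoc _ _ _).symm
  simp only [Fintype.card_sum, Fintype.card_prod, Fintype.card_fin]
  omega

lemma eventually_attainsGain_G₆ (hd : 1 ≤ d) : ∀ᶠ n in atTop,
    AttainsGain P k (P + (c * (P + 1) + d)) n (c * gain P k (2 * P + 2) + P.choose k)
      ((G₆ n (P + 1) c).copyCount (K (k + 2))) := by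
  filter_upwards [eventually_ge_atTop (P + 2 + c * (2 * P + 2))] with n hn
  have hreal := (Realizes.join_edge P k (n - (P + 2 + c * (2 * P + 2)))).sum
    ((realizes_even P k).copies c)
  refine hreal.attainsGain ?_ (by omega) (by ring)
  simp only [Fintype.card_sum, Fintype.card_prod, Fintype.card_fin]
  omega

lemma eventually_ex_le_of_copyCount_le (hP : 1 ≤ P) (hk : k + 1 ≤ P ∨ 2 * P + 2 < k + 2)
    (hd : d ≤ P) (hcd : 1 ≤ c * (P + 1) + d) : ∀ᶠ n in atTop, ∀ N : ℕ,
      (G₃ n (P + (c * (P + 1) + d)) (P + 1)).copyCount (K (k + 2)) ≤ N →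
      (G₄ n (P + 1) c d).copyCount (K (k + 2)) ≤ N →
      (1 ≤ d → d + 1 ≤ P → P ≤ c + d → (G₅ n (P + 1) c d).copyCount (K (k + 2)) ≤ N) →
      (1 ≤ d → (G₆ n (P + 1) c).copyCount (K (k + 2)) ≤ N) →
      ex n (K (k + 2)) (pathOrMatching (2 * P + 3) (P + (c * (P + 1) + d) + 1)) ≤ N := by
  rcases hk with hk | hk
  · filter_upwards [eventually_ex_le (c := c) hP hk hd, eventually_attainsGain_G₃ k c d hP hcd,
      eventually_attainsGain_G₄ k c d hd,
      eventually_all.2 fun h => eventually_attainsGain_G₅ k c d hP hd h,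
      eventually_all.2 fun h => eventually_attainsGain_G₆ (P := P) k c d h]
      with n hex h₃ h₄ h₅ h₆ N hN₃ hN₄ hN₅ hN₆
    have le_sub {x : ℤ} {N' : ℕ} (h : AttainsGain P k (P + (c * (P + 1) + d)) n x N')
        (hN : N' ≤ N) : x ≤ N - n * (P.choose (k + 1) : ℤ) - gain P k P := by
      have := h.le_count
      have : (N' : ℤ) ≤ N := Nat.cast_le.2 hN
      linarith
    exact hex N
      { three := le_sub h₃ hN₃
        four := le_sub h₄ hN₄
        five := fun h h' h'' => le_sub (h₅ h'') (hN₅ h h' h'')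
        six := fun h => le_sub (h₆ h) (hN₆ h) }
  · exact .of_forall fun n N _ _ _ _ => (ex_eq_zero (by omega)).trans_le (Nat.zero_le _)

end Attained

end BoundedMatching

open BoundedMatching SimpleGraph in
theorem theorem1p8 (r p s c d : ℕ) (hr : 2 ≤ r) (hp : 2 ≤ p) (hps : p ≤ s)
    (hrp : r ≤ p ∨ 2 * p < r)
    (hcd : s - p + 1 = c * p + d) (hd : d ≤ p - 1) :
    ∀ᶠ n : ℕ in Filter.atTop,
      let exn := ex n (K r) {⟨_, pathGraph (2 * p + 1)⟩, ⟨_, matching (s + 1)⟩}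
      let N₃ := (G₃ n s p).copyCount (K r)
      let N₄ := (G₄ n p c d).copyCount (K r)
      let N₅ := (G₅ n p c d).copyCount (K r)
      let N₆ := (G₆ n p c).copyCount (K r)
      (d = 0 → exn = max N₃ N₄) ∧
      (1 ≤ d ∧ d ≤ p - 2 →
        (p ≤ c + d + 1 → exn = max (max N₃ N₄) (max N₅ N₆)) ∧
        (c + d + 1 < p → exn = max (max N₃ N₄) N₆)) ∧
      (d = p - 1 → exn = max (max N₃ N₄) N₆) := by
  obtain ⟨k, rfl⟩ : ∃ k, r = k + 2 := ⟨r - 2, by omega⟩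
  obtain ⟨P, rfl⟩ : ∃ P, p = P + 1 := ⟨p - 1, by omega⟩
  obtain rfl : s = P + (c * (P + 1) + d) := by omega
  have hP : 1 ≤ P := by omega
  filter_upwards [eventually_ex_le_of_copyCount_le k c d hP (by omega) hd (by omega),
    eventually_attainsGain_G₃ k c d hP (by omega), eventually_attainsGain_G₄ k c d hd,
    Filter.eventually_all.2 fun h => eventually_attainsGain_G₅ k c d hP hd h,
    Filter.eventually_all.2 fun h => eventually_attainsGain_G₆ (P := P) k c d h]
    with n hle h₃ h₄ h₅ h₆
  have h₃₄ := max_le h₃.count_le_ex h₄.count_le_ex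
  refine ⟨fun hd₀ => le_antisymm (hle _ ?_ ?_ ?_ ?_) h₃₄,
    fun hd₁ => ⟨fun hc => le_antisymm (hle _ ?_ ?_ ?_ ?_)
      (max_le h₃₄ (max_le (h₅ (by omega)).count_le_ex (h₆ hd₁.1).count_le_ex)),
    fun hc => le_antisymm (hle _ ?_ ?_ ?_ ?_) (max_le h₃₄ (h₆ hd₁.1).count_le_ex)⟩,
    fun hdP => le_antisymm (hle _ ?_ ?_ ?_ ?_) (max_le h₃₄ (h₆ (by omega)).count_le_ex)⟩
  all_goals omega
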